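/- Let $n\ge 1$, $K\ge 1$, $d\ge 0$, let $x_1,\dots,x_n\in\mathbb{R}^d$ be data and $y_i=(x_i,1)\in\mathbb{R}^{d+1}$. Let $\mathbb{P}^{d+1}$ be the set of symmetric positive definite $(d+1)\times(d+1)$ matrices and $\mathcal{M}=\bigl(\prod_{j=1}^K\mathbb{P}^{d+1}\bigr)\times\mathbb{R}^{K-1}$, with points $x=(\{S_j\}_{j=1}^K,\{\omega_j\}_{j=1}^{K-1})$, tangent spaces $T_x\mathcal M=\prod_j\{\xi_j=\xi_j^T\}\times\mathbb{R}^{K-1}$, and Riemannian metric $$\langle(\xi,u),(\xi',u')\rangle_x=\sum_{j}\operatorname{tr}(S_j^{-1}\xi_jS_j^{-1}\xi_j')+\sum_{l}u_lu'_l .$$ Here $\nabla$ and $\|\cdot\|$ denote the Riemannian gradient and norm. Put $\omega_K=0$ and $\alpha_j(\omega)=e^{\omega_j}/\sum_{k=1}^Ke^{\omega_k}$. Let $\alpha,\beta,\kappa,\zeta>0$, $\nu\in\mathbb{R}$, $\lambda\in\mathbb{R}^d$, $\Lambda\in\mathbb{R}^{d\times d}$ symmetric positive definite, and assume $\rho:=\alpha(d+\nu+1)+\beta>0$.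 With $$\Psi=\begin{pmatrix}\frac{\alpha}{\beta}\Lambda+\kappa\lambda\lambda^T&\kappa\lambda\\ \kappa\lambda^T&\kappa\end{pmatrix},\quad \psi(S)=-\tfrac{\rho}{2}\log\det S-\tfrac{\beta}{2}\operatorname{tr}(\Psi S^{-1}),\quad \varphi(\omega)=\zeta\sum_{j=1}^K\log\alpha_j(\omega),$$ and $q_{\mathcal N}(y;S)=2\pi e^{1/2}(2\pi)^{-(d+1)/2}\det(S)^{-1/2}\exp(-\tfrac12y^TS^{-1}y)$, the penalized reformulated GMM log-likelihood is $$f=\frac1n\sum_{i=1}^nf_i,\qquad f_i(x)=\log\Bigl(\sum_{j=1}^K\alpha_j(\omega)\,q_{\mathcal N}(y_i;S_j)\Bigr)+\frac1n\Bigl(\sum_{j=1}^K\psi(S_j)+\varphi(\omega)\Bigr).$$ Fix $c>0$ and an initial point $x^0\in\mathcal M$. For $T\ge1$ let SGD with the Euclidean retraction and constant step size $\eta=c/\sqrt T$ be $$x^{t+1}=x^t+\eta\,\nabla f_{i_t}(x^t),\qquad t=0,1,\dots,$$ where $i_0,i_1,\dots$ are independent and uniform on $\{1,\dots,n\}$.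 Call $T$ admissible if $\frac{c}{\sqrt T}\bigl(1+\frac{\rho}{n}\bigr)\le 2$ (this holds for all large $T$, and whenever $c/\sqrt T\le1$ and $\rho\le n$). Then $f$ attains a maximum $f^*$ on $\mathcal M$, and there is a compact set $C\subset\mathcal M$, not depending on $T$, such that for every admissible $T$ and every sequence of indices all iterates $x^t$ lie in $C$. Write $f^0=f(x^0)$. Call $(L,G)$, $L\ge0$, valid on $C$ if for all $x\in C$ - $-f(x+\xi)\le -f(x)-\langle\nabla f(x),\xi\rangle_x+\frac L2\|\xi\|_x^2$ for all $\xi\in T_x\mathcal M$ with $x+\xi\in C$ (Lipschitz growth bound for the minimized function $-f$), and - $\|\nabla f_i(x)\|_x\le G$ for all $i$. (a) For all $(L,G)$ valid on $C$ and all admissible $T$, $$\min_{0\le t\le T-1}\mathbb{E}\bigl[\|\nabla f(x^t)\|^2\bigr]\le\frac1{\sqrt T}\Bigl(\frac{f^*-f^0}{c}+\frac{Lc}{2}G^2\Bigr).$$ (b) There exist $(L,G)$ valid on $C$, not depending on $T$, such that for all admissible $T$ also $$\min_{1\le t\le T}\mathbb{E}\bigl[\|\nabla f(x^t)\|^2\bigr]\le\frac1{\sqrt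 T}\Bigl(\frac{f^*-f^0}{c}+\frac{Lc}{2}G^2\Bigr).$$ In particular both minima are $O(1/\sqrt T)$ as $T\to\infty$. -/

import Mathlib

open MeasureTheory ProbabilityTheory

universe u

noncomputable section

namespace PenalizedGMM

/-- Index type of the coordinates of an augmented data point `y = (x, 1) ∈ ℝ^{d+1}`. -/
abbrev Idx (d : ℕ) : Type := Fin d ⊕ Unit

/-- Ambient vector space of the parameters `({S_j}_{j=1}^K, {ω_j}_{j=1}^{K-1})` of a mixture with
`K = k + 1` components. -/
abbrev Param (d k : ℕ) : Type := (Fin (k + 1) → Matrix (Idx d) (Idx d) ℝ) × (Fin k → ℝ)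

/-- The manifold `(∏_{j=1}^K ℙ^{d+1}) × ℝ^{K-1}`. -/
def manifold (d k : ℕ) : Set (Param d k) := {x | ∀ j, (x.1 j).PosDef}

/-- The tangent space of the manifold (the same at every point): symmetric matrices in each of the
first `K` factors, arbitrary vectors in `ℝ^{K-1}`. -/
def tangent (d k : ℕ) : Set (Param d k) := {ξ | ∀ j, (ξ.1 j).IsSymm}

/-- The product Riemannian metric: `tr(S⁻¹ ξ S⁻¹ η)` on each factor `ℙ^{d+1}` and the Euclidean
inner product on `ℝ^{K-1}`. -/
def metric {d k : ℕ} (x ξ η : Param d k) : ℝ :=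
  (∑ j, ((x.1 j)⁻¹ * ξ.1 j * (x.1 j)⁻¹ * η.1 j).trace) + ∑ l, ξ.2 l * η.2 l

/-- The Riemannian norm `‖ξ‖` of a tangent vector `ξ` at `x`. -/
def riemNorm {d k : ℕ} (x ξ : Param d k) : ℝ := Real.sqrt (metric x ξ ξ)

/-- `v` is a Riemannian gradient of `f` at `x`: a tangent vector with `Df(x)ξ = ⟨v, ξ⟩_x` for all
tangent vectors `ξ`, where `Df(x)ξ` is the derivative of `f` at `x` in direction `ξ`. -/
def IsRiemGrad {d k : ℕ} (f : Param d k → ℝ) (x v : Param d k) : Prop :=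
  v ∈ tangent d k ∧ ∀ ξ ∈ tangent d k, HasLineDerivAt ℝ f (metric x v ξ) x ξ

open Classical in
/-- The Riemannian gradient `∇f(x)` (zero by convention where there is none). At points of the
manifold it is determined by its defining property, see `IsRiemGrad.unique`. -/
def riemGrad {d k : ℕ} (f : Param d k → ℝ) (x : Param d k) : Param d k :=
  if h : ∃ v, IsRiemGrad f x v then h.choose else 0

/-- The Euclidean retraction `R_x(ξ) = x + ξ`. -/
def retr {d k : ℕ} (x ξ : Param d k) : Param d k := x + ξ

/-- `f` satisfies on `C` the Lipschitz growth bound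
`f(R_x(ξ)) ≤ f(x) + ⟨∇f(x), ξ⟩ + (L/2) ‖ξ‖²`
(for `x ∈ C` and all tangent vectors `ξ` for which `R_x(ξ)` is again in `C`). -/
def LipschitzGrowthOn {d k : ℕ} (f : Param d k → ℝ) (C : Set (Param d k)) (L : ℝ) : Prop :=
  ∀ x ∈ C, ∀ ξ ∈ tangent d k, retr x ξ ∈ C →
    f (retr x ξ) ≤ f x + metric x (riemGrad f x) ξ + L / 2 * riemNorm x ξ ^ 2

/-- The functions `f_i` have `G`-bounded gradients on `C`. -/
def GradBoundedOn {d k n : ℕ} (f : Fin n → Param d k → ℝ) (C : Set (Param d k)) (G : ℝ) : Prop :=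
  ∀ x ∈ C, ∀ i, riemNorm x (riemGrad (f i) x) ≤ G

/-- The augmented data point `y = (x, 1)`. -/
def augment {d : ℕ} (x : Fin d → ℝ) : Idx d → ℝ := Sum.elim x (fun _ => 1)

/-- The centred Gaussian density `p_N(y; S)` on `ℝ^{d+1}` with covariance matrix `S`. -/
def gaussianDensity {d : ℕ} (y : Idx d → ℝ) (S : Matrix (Idx d) (Idx d) ℝ) : ℝ :=
  (Real.sqrt ((2 * Real.pi) ^ (d + 1) * S.det))⁻¹ *
    Real.exp (-(1 / 2) * (y ⬝ᵥ S⁻¹.mulVec y))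

/-- `q_N(y; S) = 2π exp(1/2) p_N(y; S)`. -/
def qN {d : ℕ} (y : Idx d → ℝ) (S : Matrix (Idx d) (Idx d) ℝ) : ℝ :=
  2 * Real.pi * Real.exp (1 / 2) * gaussianDensity y S

/-- The mixture weights `α_j = exp(ω_j) / ∑_k exp(ω_k)`, where `ω_K = 0`. -/
def weight {k : ℕ} (w : Fin k → ℝ) (j : Fin (k + 1)) : ℝ :=
  Real.exp (Fin.snoc (α := fun _ => ℝ) w 0 j) /
    ∑ l, Real.exp (Fin.snoc (α := fun _ => ℝ) w 0 l)

/-- The parameters `α, β, κ, ν, λ, Λ` of the penalizer of the covariances and means, and the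
parameter `ζ` of the penalizer of the mixture weights. -/
structure Penalty (d : ℕ) where
  alpha : ℝ
  beta : ℝ
  kappa : ℝ
  nu : ℝ
  lam : Fin d → ℝ
  Lam : Matrix (Fin d) (Fin d) ℝ
  zeta : ℝ

/-- `ρ = α(d + ν + 1) + β`. -/
def Penalty.rho {d : ℕ} (p : Penalty d) : ℝ := p.alpha * (d + p.nu + 1) + p.beta

/-- The block matrix `Ψ = [[(α/β) Λ + κ λ λᵀ, κ λ], [κ λᵀ, κ]]`. -/
def Penalty.Psi {d : ℕ} (p : Penalty d) : Matrix (Idx d) (Idx d) ℝ :=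
  Matrix.fromBlocks
    ((p.alpha / p.beta) • p.Lam + p.kappa • Matrix.vecMulVec p.lam p.lam)
    (Matrix.of fun a _ => p.kappa * p.lam a)
    (Matrix.of fun _ b => p.kappa * p.lam b)
    (Matrix.of fun _ _ => p.kappa)

/-- `ψ(S; Ψ) = -(ρ/2) log det S - (β/2) tr(Ψ S⁻¹)`. -/
def Penalty.psi {d : ℕ} (p : Penalty d) (S : Matrix (Idx d) (Idx d) ℝ) : ℝ :=
  -(p.rho / 2) * Real.log S.det - p.beta / 2 * (p.Psi * S⁻¹).trace

/-- `φ(ω; ζ) = ζ ∑_j log α_j`. -/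
def Penalty.phi {d k : ℕ} (p : Penalty d) (w : Fin k → ℝ) : ℝ :=
  p.zeta * ∑ j, Real.log (weight w j)

/-- The penalized log-likelihood `f_i` of the `i`-th observation. -/
def component {d k n : ℕ} (p : Penalty d) (data : Fin n → Fin d → ℝ) (i : Fin n)
    (x : Param d k) : ℝ :=
  Real.log (∑ j, weight x.2 j * qN (augment (data i)) (x.1 j)) +
    1 / n * ((∑ j, p.psi (x.1 j)) + p.phi x.2)

/-- The penalized objective `f = (1/n) ∑ᵢ f_i`. -/
def objective {d k n : ℕ} (p : Penalty d) (data : Fin n → Fin d → ℝ) (x : Param d k) : ℝ :=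
  1 / n * ∑ i, component p data i x

/-- Riemannian stochastic gradient ascent with the Euclidean retraction and constant step size
`η`: `x_{t+1} = R_{x_t}(η ∇f_{i_t}(x_t))`, started at `x₀`. -/
def sgd {d k n : ℕ} (p : Penalty d) (data : Fin n → Fin d → ℝ) (η : ℝ) (x₀ : Param d k)
    (i : ℕ → Fin n) : ℕ → Param d k
  | 0 => x₀
  | t + 1 => retr (sgd p data η x₀ i t)
      (η • riemGrad (component p data (i t)) (sgd p data η x₀ i t))

/-- The random indices `i_0, i_1, …` are independent and uniformly distributed on the `n`
observations. -/
structure IsUniformSampling {n : ℕ} {Ω : Type u} [MeasurableSpace Ω] (P : Measure Ω)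
    (i : ℕ → Ω → Fin n) : Prop where
  measurable : ∀ t, Measurable (i t)
  indep : iIndepFun i P
  uniform : ∀ t a, P (i t ⁻¹' {a}) = (n : ENNReal)⁻¹

/-- `‖∇f(x_t)‖²` at the `t`-th iterate of SGD with constant step size `η`, for the sampled
indices `i`. -/
def sqGrad {d k n : ℕ} (p : Penalty d) (data : Fin n → Fin d → ℝ) (η : ℝ) (x₀ : Param d k)
    (i : ℕ → Fin n) (t : ℕ) : ℝ :=
  riemNorm (sgd p data η x₀ i t) (riemGrad (objective p data) (sgd p data η x₀ i t)) ^ 2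

/-- `𝔼[‖∇f(x_t)‖²]`. -/
def expSqGrad {d k n : ℕ} (p : Penalty d) (data : Fin n → Fin d → ℝ) (η : ℝ) (x₀ : Param d k)
    {Ω : Type u} [MeasurableSpace Ω] (P : Measure Ω) (i : ℕ → Ω → Fin n) (t : ℕ) : ℝ :=
  ∫ s, sqGrad p data η x₀ (fun r => i r s) t ∂P

open Matrix MatrixOrder in
theorem trace_metric_aux {m : Type} [Fintype m] [DecidableEq m] {S v : Matrix m m ℝ}
    (hS : S.PosDef) (hv : v.IsSymm) :
    0 ≤ (S⁻¹ * v * S⁻¹ * v).trace ∧ ((S⁻¹ * v * S⁻¹ * v).trace = 0 → v = 0) := by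
  obtain ⟨B, hB⟩ := CStarAlgebra.nonneg_iff_eq_star_mul_self.mp hS.inv.posSemidef.nonneg
  have hB' : S⁻¹ = Bᴴ * B := hB
  have hu : IsUnit B := by
    have h := hS.inv.isUnit
    rw [hB', Matrix.isUnit_iff_isUnit_det, Matrix.det_mul] at h
    exact (Matrix.isUnit_iff_isUnit_det _).2 (isUnit_of_mul_isUnit_right h)
  have hvH : vᴴ = v := by
    rw [Matrix.conjTranspose_eq_transpose_of_trivial]; exact hv
  have e : (S⁻¹ * v * S⁻¹ * v).trace = ((B * v * Bᴴ)ᴴ * (B * v * Bᴴ)).trace := by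
    rw [hB', Matrix.conjTranspose_mul, Matrix.conjTranspose_mul, hvH,
      Matrix.conjTranspose_conjTranspose]
    rw [show Bᴴ * B * v * (Bᴴ * B) * v = Bᴴ * (B * v * Bᴴ * (B * v)) by simp only [mul_assoc],
      Matrix.trace_mul_comm]
    simp only [mul_assoc]
  rw [e]
  refine ⟨(Matrix.posSemidef_conjTranspose_mul_self _).trace_nonneg, fun h => ?_⟩
  rw [Matrix.trace_conjTranspose_mul_self_eq_zero_iff] at h
  have hu2 : IsUnit Bᴴ := hu.star
  have h2 : B * v = 0 := by
    refine hu2.mul_left_injective ?_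
    simpa using h
  exact hu.mul_right_injective (by simpa using h2)

theorem metric_self_nonneg {d k : ℕ} {x v : Param d k} (hx : x ∈ manifold d k)
    (hv : v ∈ tangent d k) : 0 ≤ metric x v v :=
  add_nonneg (Finset.sum_nonneg fun j _ => (trace_metric_aux (hx j) (hv j)).1)
    (Finset.sum_nonneg fun _ _ => mul_self_nonneg _)

theorem eq_zero_of_metric_self {d k : ℕ} {x v : Param d k} (hx : x ∈ manifold d k)
    (hv : v ∈ tangent d k) (h : metric x v v = 0) : v = 0 := by
  have h1 : ∀ j ∈ Finset.univ, 0 ≤ ((x.1 j)⁻¹ * v.1 j * (x.1 j)⁻¹ * v.1 j).trace :=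
    fun j _ => (trace_metric_aux (hx j) (hv j)).1
  have h2 : ∀ l ∈ Finset.univ, 0 ≤ v.2 l * v.2 l := fun l _ => mul_self_nonneg _
  have h3 := Finset.sum_nonneg h1
  have h4 := Finset.sum_nonneg h2
  unfold metric at h
  ext1
  · funext j
    exact (trace_metric_aux (hx j) (hv j)).2
      ((Finset.sum_eq_zero_iff_of_nonneg h1).1 (by linarith) j (Finset.mem_univ j))
  · funext l
    exact mul_self_eq_zero.1
      ((Finset.sum_eq_zero_iff_of_nonneg h2).1 (by linarith) l (Finset.mem_univ l))

/-- At a point of the manifold there is at most one Riemannian gradient. -/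
theorem IsRiemGrad.unique {d k : ℕ} {f : Param d k → ℝ} {x v w : Param d k}
    (hx : x ∈ manifold d k) (hv : IsRiemGrad f x v) (hw : IsRiemGrad f x w) : v = w := by
  have ht : v - w ∈ tangent d k := fun j => (hv.1 j).sub (hw.1 j)
  have e : metric x v (v - w) = metric x w (v - w) :=
    (hv.2 _ ht).unique (hw.2 _ ht)
  have e2 : metric x (v - w) (v - w) = metric x v (v - w) - metric x w (v - w) := by
    simp only [metric, Prod.fst_sub, Prod.snd_sub, Pi.sub_apply, mul_sub, sub_mul,
      Matrix.trace_sub, Finset.sum_sub_distrib]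
    ring
  exact sub_eq_zero.1 (eq_zero_of_metric_self hx ht (by rw [e2, e, sub_self]))

end PenalizedGMM

end

namespace PenalizedGMM

open Matrix Topology

/-! Three facts carry the theorem: the iterates cannot leave a fixed compact set, the objective is
coercive, and nonconvex SGD satisfies the usual descent estimate.

Confinement. The Riemannian gradient in `S` is `S` times the Euclidean gradient times `S`, so all
inverses cancel and a step is affine in `S`: the new matrix is `(1 - η/2 (h + ρ/n)) S + η/2 (h y yᵀ
+ (β/n) Ψ)`, with `h ∈ [0, 1]` the posterior probability of the component. Admissibility says
exactly that the first coefficient is nonnegative for every such `h`, so a small lower bound `c • 1`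
and a large trace bound both persist. For the weights, the penalty pushes a coordinate `ω_l` up once
its weight is small. The increments of all `K` logit directions sum to zero, so the same push on the
last weight bounds `∑ ω_l` from above. These four conditions define a convex compact `box` that
depends on `x₀` but not on the step size (`exists_invariant_box`).

Maximum. In terms of the logarithms `u` of the eigenvalues, the objective is bounded by a sum of
one-variable functions `eigenBound` tending to `-∞` at both ends, plus a multiple of `∑ log α_j ≤
0`. Superlevel sets therefore lie in another such box (`exists_box_of_le_objective`).

Rate. On a convex compact subset of the manifold, smoothness yields constants `L` and `G`. Since
`i_t` is independent of the history that determines `x_t`, the expectation of `⟨∇f, ∇f_{i_t}⟩` is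
that of `‖∇f‖²` (`expSqGrad_step`). Telescoping and bounding a minimum by an average finish part
(a). The window `1, …, T` of part (b) costs one additional step, which is absorbed by doubling `L`.
-/

theorem posDef_of_sub {m : Type*} [DecidableEq m] {A : Matrix m m ℝ} {c : ℝ} (hc : 0 < c) (h : (A - c • 1).PosSemidef) :
    A.PosDef := by
  rw [← sub_add_cancel A (c • 1)]
  exact PosDef.posSemidef_add h (PosDef.one.smul hc)

/-! ### Spectral form of positive definite matrices; trace inequalities. -/

section MatrixLemmas

variable {m : Type*} [Fintype m] [DecidableEq m]

theorem posDef_spectral {A : Matrix m m ℝ} (hA : A.PosDef) :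
    ∃ (U : Matrix m m ℝ) (l : m → ℝ), (∀ i, 0 < l i) ∧ U * Uᵀ = 1 ∧ Uᵀ * U = 1 ∧
      A = U * diagonal l * Uᵀ := by
  refine ⟨hA.1.eigenvectorUnitary, hA.1.eigenvalues, hA.eigenvalues_pos, ?_, ?_, ?_⟩
  · have h := Unitary.coe_mul_star_self hA.1.eigenvectorUnitary
    rwa [Unitary.coe_star, star_eq_conjTranspose, conjTranspose_eq_transpose_of_trivial] at h
  · have h := Unitary.coe_star_mul_self hA.1.eigenvectorUnitary
    rwa [star_eq_conjTranspose, conjTranspose_eq_transpose_of_trivial] at h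
  · have h := hA.1.spectral_theorem
    rw [Unitary.conjStarAlgAut_apply, star_eq_conjTranspose,
      conjTranspose_eq_transpose_of_trivial] at h
    exact h

theorem posSemidef_spectral_sub {A U : Matrix m m ℝ} {l : m → ℝ} {c : ℝ}
    (hU : U * Uᵀ = 1) (hA : A = U * diagonal l * Uᵀ) (hc : ∀ i, c ≤ l i) :
    (A - c • 1).PosSemidef := by
  have h : A - c • 1 = U * diagonal (fun i => l i - c) * Uᴴ := by
    rw [conjTranspose_eq_transpose_of_trivial,
      show (diagonal fun i => l i - c) = diagonal l - c • (1 : Matrix m m ℝ) by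
        rw [smul_one_eq_diagonal, ← diagonal_sub],
      mul_sub, sub_mul, ← hA, mul_smul_comm, mul_one, smul_mul_assoc, hU]
  rw [h]
  exact (PosSemidef.diagonal fun i => sub_nonneg.2 (hc i)).mul_mul_conjTranspose_same U

theorem det_spectral {A U : Matrix m m ℝ} {l : m → ℝ}
    (hU : U * Uᵀ = 1) (hA : A = U * diagonal l * Uᵀ) : A.det = ∏ i, l i := by
  have h : U.det * Uᵀ.det = 1 := by rw [← det_mul, hU, det_one]
  rw [hA, det_mul, det_mul, det_diagonal, mul_right_comm, h, one_mul]

theorem trace_spectral {A U : Matrix m m ℝ} {l : m → ℝ}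
    (hU : Uᵀ * U = 1) (hA : A = U * diagonal l * Uᵀ) : A.trace = ∑ i, l i := by
  rw [hA, trace_mul_comm, ← mul_assoc, hU, one_mul, trace_diagonal]

theorem inv_spectral {A U : Matrix m m ℝ} {l : m → ℝ} (hl : ∀ i, 0 < l i)
    (hU : U * Uᵀ = 1) (hU' : Uᵀ * U = 1) (hA : A = U * diagonal l * Uᵀ) :
    A⁻¹ = U * diagonal (fun i => (l i)⁻¹) * Uᵀ := by
  apply inv_eq_right_inv
  have h : diagonal l * diagonal (fun i => (l i)⁻¹) = 1 := by
    rw [diagonal_mul_diagonal, ← diagonal_one]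
    congr 1
    funext i
    exact mul_inv_cancel₀ (hl i).ne'
  calc A * (U * diagonal (fun i => (l i)⁻¹) * Uᵀ)
      = U * diagonal l * (Uᵀ * U) * diagonal (fun i => (l i)⁻¹) * Uᵀ := by
        rw [hA]; simp only [mul_assoc]
    _ = 1 := by rw [hU', mul_one, mul_assoc U, h, mul_one, hU]

theorem exists_pos_posSemidef_sub {A : Matrix m m ℝ} (hA : A.PosDef) :
    ∃ c : ℝ, 0 < c ∧ (A - c • 1).PosSemidef := by
  obtain ⟨U, l, hl, hU, -, h⟩ := posDef_spectral hA
  have hs : 0 ≤ ∑ i, (l i)⁻¹ := Finset.sum_nonneg fun i _ => (inv_pos.2 (hl i)).le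
  -- The inverse of `1 + ∑ 1/l_i` lies below every eigenvalue; the summand `1` keeps it meaningful
  -- for an empty index type.
  refine ⟨(1 + ∑ i, (l i)⁻¹)⁻¹, by positivity, posSemidef_spectral_sub hU h fun i => ?_⟩
  refine inv_le_of_inv_le₀ (hl i) ?_
  have := Finset.single_le_sum (f := fun i => (l i)⁻¹) (fun i _ => (inv_pos.2 (hl i)).le)
    (Finset.mem_univ i)
  linarith

open MatrixOrder in
theorem trace_mul_nonneg {A B : Matrix m m ℝ} (hA : A.PosSemidef) (hB : B.PosSemidef) :
    0 ≤ (A * B).trace := by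
  obtain ⟨C, hC⟩ := CStarAlgebra.nonneg_iff_eq_star_mul_self.1 hB.nonneg
  rw [hC, star_eq_conjTranspose, ← mul_assoc, trace_mul_comm, ← mul_assoc]
  exact (hA.mul_mul_conjTranspose_same C).trace_nonneg

/-- Testing the quadratic form on `e_i ± e_j` gives `2 |A i j| ≤ A i i + A j j`. This turns a trace
bound into boundedness of the `box`. -/
theorem abs_apply_le_trace {A : Matrix m m ℝ} (hA : A.PosSemidef) (i j : m) :
    |A i j| ≤ A.trace := by
  have hd : ∀ i, 0 ≤ A i i := fun i => hA.diag_nonneg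
  have hle : ∀ i, A i i ≤ A.trace := fun i =>
    Finset.single_le_sum (f := fun i => A i i) (fun i _ => hd i) (Finset.mem_univ i)
  have hs : A j i = A i j := by simpa using hA.1.apply i j
  have h : ∀ s : ℝ, 0 ≤ A i i + 2 * s * A i j + s ^ 2 * A j j := fun s => by
    have := hA.dotProduct_mulVec_nonneg (Pi.single i 1 + Pi.single j s)
    simp [mulVec_add, add_dotProduct, hs] at this
    linarith
  have h1 := h 1
  have h2 := h (-1)
  rw [abs_le]
  constructor <;> linarith [hle i, hle j]

end MatrixLemmas

/-! ### Convex compact boxes of parameters. -/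

/-- The parameters whose covariances are bounded from below by `c` and have trace at most `M`, and
whose weight parameters are bounded from below, with a bounded sum. -/
def box {d k : ℕ} (c M : ℝ) (a : Fin k → ℝ) (b : ℝ) : Set (Param d k) :=
  {x | (∀ j, (x.1 j - c • 1).PosSemidef) ∧ (∀ j, (x.1 j).trace ≤ M) ∧
    (∀ l, a l ≤ x.2 l) ∧ ∑ l, x.2 l ≤ b}

theorem box_subset_manifold {d k : ℕ} {c M : ℝ} {a : Fin k → ℝ} {b : ℝ} (hc : 0 < c) :
    box c M a b ⊆ manifold d k := fun _ hx j => posDef_of_sub hc (hx.1 j)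

theorem convex_box {d k : ℕ} {c M : ℝ} {a : Fin k → ℝ} {b : ℝ} :
    Convex ℝ (box c M a b : Set (Param d k)) := by
  intro x hx y hy s t hs ht hst
  refine ⟨fun j => ?_, fun j => ?_, fun l => ?_, ?_⟩
  · have : (s • x + t • y).1 j - c • 1 = s • (x.1 j - c • 1) + t • (y.1 j - c • 1) := by
      simp only [Prod.fst_add, Prod.smul_fst, Pi.add_apply, Pi.smul_apply, smul_sub, smul_smul]
      rw [show c = s * c + t * c by rw [← add_mul, hst, one_mul], add_smul]
      simp only [← add_mul, hst, one_mul]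
      abel
    rw [this]
    exact ((hx.1 j).smul hs).add ((hy.1 j).smul ht)
  · simp only [Prod.fst_add, Prod.smul_fst, Pi.add_apply, Pi.smul_apply, trace_add, trace_smul,
      smul_eq_mul]
    calc _ ≤ s * M + t * M := by gcongr <;> [exact hx.2.1 j; exact hy.2.1 j]
      _ = M := by rw [← add_mul, hst, one_mul]
  · simp only [Prod.snd_add, Prod.smul_snd, Pi.add_apply, Pi.smul_apply, smul_eq_mul]
    calc a l = s * a l + t * a l := by rw [← add_mul, hst, one_mul]
      _ ≤ _ := by gcongr <;> [exact hx.2.2.1 l; exact hy.2.2.1 l]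
  · simp only [Prod.snd_add, Prod.smul_snd, Pi.add_apply, Pi.smul_apply, smul_eq_mul,
      Finset.sum_add_distrib, ← Finset.mul_sum]
    calc _ ≤ s * b + t * b := by gcongr <;> [exact hx.2.2.2; exact hy.2.2.2]
      _ = b := by rw [← add_mul, hst, one_mul]

theorem isClosed_posSemidef {m : Type*} [Fintype m] :
    IsClosed {A : Matrix m m ℝ | A.PosSemidef} := by
  simp only [posSemidef_iff_dotProduct_mulVec, IsHermitian, Set.ofPred_and, Set.ofPred_forall]
  refine (isClosed_eq (by fun_prop) (by fun_prop)).inter (isClosed_iInter fun x => ?_)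
  exact isClosed_le (by fun_prop) (by fun_prop)

theorem isClosed_box {d k : ℕ} {c M : ℝ} {a : Fin k → ℝ} {b : ℝ} :
    IsClosed (box c M a b : Set (Param d k)) := by
  simp only [box, Set.ofPred_and, Set.ofPred_forall]
  refine (isClosed_iInter fun j => ?_).inter ((isClosed_iInter fun j => ?_).inter
    ((isClosed_iInter fun l => ?_).inter ?_))
  · exact isClosed_posSemidef.preimage (f := fun x : Param d k => x.1 j - c • 1) (by fun_prop)
  · exact isClosed_le (by fun_prop) (by fun_prop)
  · exact isClosed_le (by fun_prop) (by fun_prop)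
  · exact isClosed_le (by fun_prop) (by fun_prop)

theorem isCompact_box {d k : ℕ} {c M : ℝ} {a : Fin k → ℝ} {b : ℝ} (hc : 0 < c) :
    IsCompact (box c M a b : Set (Param d k)) := by
  have h1 : IsCompact (Set.univ.pi fun _ : Fin (k + 1) => Set.univ.pi fun _ : Idx d =>
      Set.univ.pi fun _ : Idx d => Set.Icc (-M) M) :=
    isCompact_univ_pi fun _ => isCompact_univ_pi fun _ => isCompact_univ_pi fun _ => isCompact_Icc
  have h2 : IsCompact (Set.univ.pi fun l : Fin k => Set.Icc (a l) (b - ∑ l', a l' + a l)) :=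
    isCompact_univ_pi fun _ => isCompact_Icc
  refine (h1.prod h2).of_isClosed_subset isClosed_box fun x hx => ⟨fun j _ r _ s _ => ?_,
    fun l _ => ⟨hx.2.2.1 l, ?_⟩⟩
  · exact abs_le.1 ((abs_apply_le_trace (posDef_of_sub hc (hx.1 j)).posSemidef r s).trans
      (hx.2.1 j))
  -- The sum bound and the lower bounds on the other coordinates bound each coordinate from above.
  · have h3 := Finset.single_le_sum (f := fun l => x.2 l - a l)
      (fun l _ => sub_nonneg.2 (hx.2.2.1 l)) (Finset.mem_univ l)
    rw [Finset.sum_sub_distrib] at h3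
    linarith [hx.2.2.2]

/-! ### Derivatives of determinant and inverse along lines. -/

section MatrixDerivatives

variable {m : Type*} [Fintype m] [DecidableEq m] {S : Matrix m m ℝ}

theorem continuousAt_inv_line (hS : S.det ≠ 0) (ξ : Matrix m m ℝ) :
    ContinuousAt (fun t : ℝ => (S + t • ξ)⁻¹) 0 := by
  have h : ContinuousAt (fun A : Matrix m m ℝ => A⁻¹) (S + (0 : ℝ) • ξ) := by
    refine continuousAt_matrix_inv _ ?_
    rw [Ring.inverse_eq_inv', zero_smul, add_zero]
    exact continuousAt_inv₀ hS
  exact h.comp (f := fun t : ℝ => S + t • ξ) (by fun_prop)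

theorem eventually_det_line_pos (hS : 0 < S.det) (ξ : Matrix m m ℝ) :
    ∀ᶠ t : ℝ in 𝓝 0, 0 < (S + t • ξ).det := by
  have h : ContinuousAt (fun t : ℝ => (S + t • ξ).det) 0 := by fun_prop
  exact h.eventually_const_lt (by simpa using hS)

theorem hasDerivAt_det_line (hS : S.det ≠ 0) (ξ : Matrix m m ℝ) :
    HasDerivAt (fun t : ℝ => (S + t • ξ).det) (S.det * (S⁻¹ * ξ).trace) 0 := by
  -- Factor out `S`; then `det (1 + t M)` is a polynomial in `t` with constant term `1` and linear
  -- coefficient `tr M`.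
  have e : ∀ t : ℝ, (S + t • ξ).det = S.det * (1 + (S⁻¹ * ξ).trace * t +
      (det (1 + (Polynomial.X : Polynomial ℝ) • (S⁻¹ * ξ).map Polynomial.C)).divX.divX.eval t *
        t ^ 2) := fun t => by
    rw [← det_one_add_smul, ← det_mul, mul_add, mul_one, mul_smul_comm, ← mul_assoc,
      mul_nonsing_inv _ hS.isUnit, one_mul]
  simp_rw [e]
  generalize (det (1 + (Polynomial.X : Polynomial ℝ) •
    (S⁻¹ * ξ).map Polynomial.C)).divX.divX = q
  have h := ((((hasDerivAt_id (0 : ℝ)).const_mul (S⁻¹ * ξ).trace).const_add 1).add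
    ((q.hasDerivAt 0).mul ((hasDerivAt_id (0 : ℝ)).pow 2))).const_mul S.det
  refine h.congr_deriv ?_
  simp

theorem hasDerivAt_log_det_line (hS : 0 < S.det) (ξ : Matrix m m ℝ) :
    HasDerivAt (fun t : ℝ => Real.log (S + t • ξ).det) (S⁻¹ * ξ).trace 0 := by
  have h := (hasDerivAt_det_line hS.ne' ξ).log (by simpa using hS.ne')
  refine h.congr_deriv ?_
  rw [zero_smul, add_zero, mul_div_cancel_left₀ _ hS.ne']

theorem hasDerivAt_trace_mul_inv_line (hS : 0 < S.det) (W ξ : Matrix m m ℝ) :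
    HasDerivAt (fun t : ℝ => (W * (S + t • ξ)⁻¹).trace) (-(S⁻¹ * W * S⁻¹ * ξ).trace) 0 := by
  rw [hasDerivAt_iff_tendsto_slope]
  have hlim : Filter.Tendsto (fun t : ℝ => -(W * (S + t • ξ)⁻¹ * ξ * S⁻¹).trace) (𝓝[≠] 0)
      (𝓝 (-(S⁻¹ * W * S⁻¹ * ξ).trace)) := by
    have hc := continuousAt_inv_line hS.ne' ξ
    have h : ContinuousAt (fun t : ℝ => -(W * (S + t • ξ)⁻¹ * ξ * S⁻¹).trace) 0 := by
      have hg : Continuous fun A : Matrix m m ℝ => -(W * A * ξ * S⁻¹).trace := by fun_prop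
      exact hg.continuousAt.comp hc
    have h2 := h.tendsto
    rw [zero_smul, add_zero, trace_mul_comm, ← mul_assoc, ← mul_assoc] at h2
    exact h2.mono_left nhdsWithin_le_nhds
  refine hlim.congr' ?_
  filter_upwards [(eventually_det_line_pos hS ξ).filter_mono nhdsWithin_le_nhds,
    self_mem_nhdsWithin] with t ht ht0
  -- The resolvent identity makes the difference quotient explicit, so only continuity of the
  -- inverse is needed.
  have hid : (S + t • ξ)⁻¹ - S⁻¹ = -(t • ((S + t • ξ)⁻¹ * ξ * S⁻¹)) := by
    have h1 : (S + t • ξ)⁻¹ * (S + t • ξ) = 1 := nonsing_inv_mul _ ht.ne'.isUnit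
    have h2 : S * S⁻¹ = 1 := mul_nonsing_inv _ hS.ne'.isUnit
    calc (S + t • ξ)⁻¹ - S⁻¹
        = (S + t • ξ)⁻¹ * (S * S⁻¹) - (S + t • ξ)⁻¹ * (S + t • ξ) * S⁻¹ := by
          rw [h1, h2, mul_one, one_mul]
      _ = _ := by
          rw [mul_add, add_mul, ← mul_assoc, mul_smul_comm, smul_mul_assoc]
          abel
  rw [slope_def_field, sub_zero, zero_smul, add_zero, ← trace_sub, ← mul_sub, hid, mul_neg,
    trace_neg, mul_smul_comm, trace_smul, smul_eq_mul, neg_div, mul_div_cancel_left₀ _ ht0]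
  simp only [mul_assoc]

end MatrixDerivatives

/-! ### Softmax weights. -/

section Weights

variable {k : ℕ}

/-- The unnormalized exponents of the weights, `ω_K = 0` included. -/
noncomputable def logit (w : Fin k → ℝ) : Fin (k + 1) → ℝ := Fin.snoc (α := fun _ => ℝ) w 0

@[simp] theorem logit_castSucc (w : Fin k → ℝ) (l : Fin k) : logit w l.castSucc = w l :=
  Fin.snoc_castSucc (α := fun _ => ℝ) _ _ _

@[simp] theorem logit_last (w : Fin k → ℝ) : logit w (Fin.last k) = 0 :=
  Fin.snoc_last (α := fun _ => ℝ) _ _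

theorem logit_add_smul (w u : Fin k → ℝ) (t : ℝ) (j : Fin (k + 1)) :
    logit (w + t • u) j = logit w j + t * logit u j := by
  induction j using Fin.lastCases <;> simp

theorem weight_eq (w : Fin k → ℝ) (j : Fin (k + 1)) :
    weight w j = Real.exp (logit w j) / ∑ l, Real.exp (logit w l) := rfl

theorem sum_exp_pos (w : Fin k → ℝ) : 0 < ∑ l, Real.exp (logit w l) :=
  Finset.sum_pos (fun _ _ => Real.exp_pos _) Finset.univ_nonempty

theorem weight_pos (w : Fin k → ℝ) (j : Fin (k + 1)) : 0 < weight w j :=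
  div_pos (Real.exp_pos _) (sum_exp_pos w)

theorem sum_weight (w : Fin k → ℝ) : ∑ j, weight w j = 1 := by
  simp_rw [weight_eq]
  rw [← Finset.sum_div, div_self (sum_exp_pos w).ne']

theorem weight_le_one (w : Fin k → ℝ) (j : Fin (k + 1)) : weight w j ≤ 1 := by
  rw [← sum_weight w]
  exact Finset.single_le_sum (fun l _ => (weight_pos w l).le) (Finset.mem_univ j)

theorem weight_le_exp_sub (w : Fin k → ℝ) (j l : Fin (k + 1)) :
    weight w j ≤ Real.exp (logit w j - logit w l) := by
  rw [weight_eq, Real.exp_sub]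
  exact div_le_div_of_nonneg_left (Real.exp_pos _).le (Real.exp_pos _)
    (Finset.single_le_sum (f := fun l => Real.exp (logit w l)) (fun l _ => (Real.exp_pos _).le)
      (Finset.mem_univ l))

theorem weight_castSucc_le (w : Fin k → ℝ) (l : Fin k) :
    weight w l.castSucc ≤ Real.exp (w l) := by
  simpa using weight_le_exp_sub w l.castSucc (Fin.last k)

theorem weight_last_le (w : Fin k → ℝ) (l : Fin k) :
    weight w (Fin.last k) ≤ Real.exp (-w l) := by
  simpa using weight_le_exp_sub w (Fin.last k) l.castSucc

theorem log_weight (w : Fin k → ℝ) (j : Fin (k + 1)) :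
    Real.log (weight w j) = logit w j - Real.log (∑ l, Real.exp (logit w l)) := by
  rw [weight_eq, Real.log_div (Real.exp_ne_zero _) (sum_exp_pos w).ne', Real.log_exp]

theorem hasDerivAt_log_weight (w u : Fin k → ℝ) (j : Fin (k + 1)) :
    HasDerivAt (fun t : ℝ => Real.log (weight (w + t • u) j))
      (logit u j - ∑ l, weight w l * logit u l) 0 := by
  simp_rw [log_weight, logit_add_smul]
  have hl : ∀ l, HasDerivAt (fun t : ℝ => logit w l + t * logit u l) (logit u l) 0 := fun l => by
    simpa using ((hasDerivAt_id (0 : ℝ)).mul_const (logit u l)).const_add (logit w l)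
  have hs := (HasDerivAt.fun_sum (u := Finset.univ) fun l _ => (hl l).exp).log
    (by simpa using (sum_exp_pos w).ne')
  refine ((hl j).sub hs).congr_deriv ?_
  simp only [zero_mul, add_zero, weight_eq, Finset.sum_div]
  congr 1
  exact Finset.sum_congr rfl fun l _ => by ring

end Weights

/-! ### Logarithms of the Gaussian factor and of the penalties. -/

section Density

variable {d : ℕ}

/-- The part of `log q_N(y; S)` that does not depend on `y` and `S`. -/
noncomputable def logConst (d : ℕ) : ℝ :=
  Real.log (2 * Real.pi) + 1 / 2 - (d + 1) / 2 * Real.log (2 * Real.pi)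

/-- `log q_N(y; S)`. -/
noncomputable def logQ (y : Idx d → ℝ) (S : Matrix (Idx d) (Idx d) ℝ) : ℝ :=
  logConst d - 1 / 2 * Real.log S.det - 1 / 2 * (vecMulVec y y * S⁻¹).trace

theorem qN_eq_exp (y : Idx d → ℝ) {S : Matrix (Idx d) (Idx d) ℝ} (hS : 0 < S.det) :
    qN y S = Real.exp (logQ y S) := by
  have hpi : 0 < 2 * Real.pi := by positivity
  have h1 : (Real.sqrt ((2 * Real.pi) ^ (d + 1) * S.det))⁻¹ =
      Real.exp (-((d + 1) / 2 * Real.log (2 * Real.pi)) - 1 / 2 * Real.log S.det) := by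
    rw [← Real.exp_log (Real.sqrt_pos.2 (mul_pos (pow_pos hpi (d + 1)) hS)), ← Real.exp_neg,
      Real.log_sqrt (by positivity), Real.log_mul (by positivity) hS.ne', Real.log_pow]
    congr 1
    push_cast
    ring
  have h2 : y ⬝ᵥ S⁻¹ *ᵥ y = (vecMulVec y y * S⁻¹).trace := by
    rw [vecMulVec_mul, trace_vecMulVec, dotProduct_mulVec, dotProduct_comm]
  rw [qN, gaussianDensity, h1, h2, ← Real.exp_add]
  nth_rw 1 [← Real.exp_log hpi]
  rw [← Real.exp_add, ← Real.exp_add, logQ, logConst]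
  congr 1
  ring

theorem hasDerivAt_logQ (y : Idx d → ℝ) {S : Matrix (Idx d) (Idx d) ℝ} (hS : 0 < S.det)
    (ξ : Matrix (Idx d) (Idx d) ℝ) :
    HasDerivAt (fun t : ℝ => logQ y (S + t • ξ))
      (1 / 2 * ((S⁻¹ * vecMulVec y y * S⁻¹ * ξ).trace - (S⁻¹ * ξ).trace)) 0 := by
  have h := (((hasDerivAt_log_det_line hS ξ).const_mul (1 / 2)).const_sub (logConst d)).sub
    ((hasDerivAt_trace_mul_inv_line hS (vecMulVec y y) ξ).const_mul (1 / 2))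
  refine h.congr_deriv ?_
  ring

theorem hasDerivAt_psi (p : Penalty d) {S : Matrix (Idx d) (Idx d) ℝ} (hS : 0 < S.det)
    (ξ : Matrix (Idx d) (Idx d) ℝ) :
    HasDerivAt (fun t : ℝ => p.psi (S + t • ξ))
      (1 / 2 * (p.beta * (S⁻¹ * p.Psi * S⁻¹ * ξ).trace - p.rho * (S⁻¹ * ξ).trace)) 0 := by
  have h := ((hasDerivAt_log_det_line hS ξ).const_mul (-(p.rho / 2))).sub
    ((hasDerivAt_trace_mul_inv_line hS p.Psi ξ).const_mul (p.beta / 2))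
  refine h.congr_deriv ?_
  ring

theorem hasDerivAt_phi {k : ℕ} (p : Penalty d) (w u : Fin k → ℝ) :
    HasDerivAt (fun t : ℝ => p.phi (w + t • u))
      (∑ j, p.zeta * (1 - (k + 1) * weight w j) * logit u j) 0 := by
  have h := (HasDerivAt.fun_sum (u := Finset.univ) fun j _ =>
    hasDerivAt_log_weight w u j).const_mul p.zeta
  refine h.congr_deriv ?_
  rw [Finset.sum_sub_distrib, Finset.sum_const, Finset.card_univ, Fintype.card_fin, nsmul_eq_mul,
    Finset.mul_sum, ← Finset.sum_sub_distrib, Finset.mul_sum]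
  refine Finset.sum_congr rfl fun j _ => ?_
  push_cast
  ring

end Density

/-! ### Closed form of the Riemannian gradients. -/

section Gradient

variable {d k n : ℕ}

theorem manifold_det_pos {x : Param d k} (hx : x ∈ manifold d k) (j : Fin (k + 1)) :
    0 < (x.1 j).det := (hx j).det_pos

/-- The `j`-th summand of the mixture density. -/
noncomputable def mixTerm (y : Idx d → ℝ) (x : Param d k) (j : Fin (k + 1)) : ℝ :=
  weight x.2 j * qN y (x.1 j)

/-- The posterior probabilities of the components given the observation. -/
noncomputable def posterior (y : Idx d → ℝ) (x : Param d k) (j : Fin (k + 1)) : ℝ :=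
  mixTerm y x j / ∑ l, mixTerm y x l

theorem mixTerm_eq_exp (y : Idx d → ℝ) {x : Param d k} {j : Fin (k + 1)}
    (hx : 0 < (x.1 j).det) :
    mixTerm y x j = Real.exp (Real.log (weight x.2 j) + logQ y (x.1 j)) := by
  rw [mixTerm, qN_eq_exp y hx, Real.exp_add, Real.exp_log (weight_pos _ _)]

theorem mixTerm_pos (y : Idx d → ℝ) {x : Param d k} {j : Fin (k + 1)}
    (hx : 0 < (x.1 j).det) : 0 < mixTerm y x j := by
  rw [mixTerm_eq_exp y hx]
  exact Real.exp_pos _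

theorem sum_mixTerm_pos (y : Idx d → ℝ) {x : Param d k} (hx : ∀ j, 0 < (x.1 j).det) :
    0 < ∑ j, mixTerm y x j :=
  Finset.sum_pos (fun j _ => mixTerm_pos y (hx j)) Finset.univ_nonempty

theorem posterior_nonneg (y : Idx d → ℝ) {x : Param d k} (hx : x ∈ manifold d k)
    (j : Fin (k + 1)) : 0 ≤ posterior y x j :=
  (div_pos (mixTerm_pos y (manifold_det_pos hx j)) (sum_mixTerm_pos y (manifold_det_pos hx))).le

theorem sum_posterior (y : Idx d → ℝ) {x : Param d k} (hx : x ∈ manifold d k) :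
    ∑ j, posterior y x j = 1 := by
  unfold posterior
  rw [← Finset.sum_div, div_self (sum_mixTerm_pos y (manifold_det_pos hx)).ne']

theorem posterior_le_one (y : Idx d → ℝ) {x : Param d k} (hx : x ∈ manifold d k)
    (j : Fin (k + 1)) : posterior y x j ≤ 1 := by
  rw [← sum_posterior y hx]
  exact Finset.single_le_sum (fun l _ => posterior_nonneg y hx l) (Finset.mem_univ j)

/-- The `j`-th coordinate of the gradient of `f_i` with respect to the weight parameters. -/
noncomputable def drift (p : Penalty d) (n : ℕ) (y : Idx d → ℝ) (x : Param d k)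
    (j : Fin (k + 1)) : ℝ :=
  posterior y x j - weight x.2 j + p.zeta / n * (1 - (k + 1) * weight x.2 j)

/-- The Riemannian gradient of `f_i` in closed form. -/
noncomputable def componentGrad (p : Penalty d) (data : Fin n → Fin d → ℝ) (i : Fin n)
    (x : Param d k) : Param d k :=
  (fun j => (1 / 2 : ℝ) • (posterior (augment (data i)) x j •
      (vecMulVec (augment (data i)) (augment (data i)) - x.1 j) +
        (1 / n : ℝ) • (p.beta • p.Psi - p.rho • x.1 j)),
    fun l => drift p n (augment (data i)) x l.castSucc)

theorem hasDerivAt_mixTerm (y : Idx d → ℝ) {x : Param d k} (hx : x ∈ manifold d k)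
    (ξ : Param d k) (j : Fin (k + 1)) :
    HasDerivAt (fun t : ℝ => mixTerm y (x + t • ξ) j)
      (mixTerm y x j * (logit ξ.2 j - ∑ l, weight x.2 l * logit ξ.2 l +
        1 / 2 * (((x.1 j)⁻¹ * vecMulVec y y * (x.1 j)⁻¹ * ξ.1 j).trace -
          ((x.1 j)⁻¹ * ξ.1 j).trace))) 0 := by
  have h := ((hasDerivAt_log_weight x.2 ξ.2 j).fun_add
    (hasDerivAt_logQ y (manifold_det_pos hx j) (ξ.1 j))).exp
  rw [zero_smul, zero_smul, add_zero, add_zero, ← mixTerm_eq_exp y (manifold_det_pos hx j)] at h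
  refine h.congr_of_eventuallyEq ?_
  filter_upwards [eventually_det_line_pos (manifold_det_pos hx j) (ξ.1 j)] with t ht
  exact mixTerm_eq_exp (x := x + t • ξ) y ht

theorem isRiemGrad_component (p : Penalty d) (hP : p.Psi.IsSymm) (data : Fin n → Fin d → ℝ)
    (i : Fin n) {x : Param d k} (hx : x ∈ manifold d k) :
    IsRiemGrad (component p data i) x (componentGrad p data i x) := by
  constructor
  · intro j
    have h1 : (x.1 j).IsSymm := (hx j).1
    have h2 : (vecMulVec (augment (data i)) (augment (data i))).IsSymm :=
      transpose_vecMulVec _ _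
    exact (((h2.sub h1).smul _).add (((hP.smul _).sub (h1.smul _)).smul _)).smul _
  · intro ξ _
    set y := augment (data i) with hy
    have hmix := (HasDerivAt.fun_sum (u := Finset.univ) fun j _ =>
      hasDerivAt_mixTerm y hx ξ j).log
        (by simpa using (sum_mixTerm_pos y (manifold_det_pos hx)).ne')
    have hpsi := HasDerivAt.fun_sum (u := Finset.univ) fun j _ =>
      hasDerivAt_psi p (manifold_det_pos hx j) (ξ.1 j)
    have h := hmix.add ((hpsi.add (hasDerivAt_phi p x.2 ξ.2)).const_mul (1 / n : ℝ))
    refine h.congr_deriv ?_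
    rw [zero_smul, add_zero, metric]
    have e1 : ∀ j, ((x.1 j)⁻¹ * (componentGrad p data i x).1 j * (x.1 j)⁻¹ * ξ.1 j).trace =
        posterior y x j * (1 / 2 * (((x.1 j)⁻¹ * vecMulVec y y * (x.1 j)⁻¹ * ξ.1 j).trace -
          ((x.1 j)⁻¹ * ξ.1 j).trace)) +
        1 / n * (1 / 2 * (p.beta * ((x.1 j)⁻¹ * p.Psi * (x.1 j)⁻¹ * ξ.1 j).trace -
          p.rho * ((x.1 j)⁻¹ * ξ.1 j).trace)) := fun j => by
      have hu : (x.1 j)⁻¹ * x.1 j * (x.1 j)⁻¹ = (x.1 j)⁻¹ := by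
        rw [nonsing_inv_mul _ (manifold_det_pos hx j).ne'.isUnit, one_mul]
      simp only [componentGrad, ← hy, mul_add, add_mul, mul_sub, sub_mul, mul_smul_comm,
        smul_mul_assoc, trace_add, trace_sub, trace_smul, smul_eq_mul, hu]
      ring
    -- The last component may be included because its logit direction is zero.
    have e2 : ∑ l, (componentGrad p data i x).2 l * ξ.2 l =
        ∑ j, drift p n y x j * logit ξ.2 j := by
      rw [Fin.sum_univ_castSucc]
      simp [componentGrad, hy]
    have e3 : (∑ j, mixTerm y x j * (logit ξ.2 j - ∑ l, weight x.2 l * logit ξ.2 l +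
        1 / 2 * (((x.1 j)⁻¹ * vecMulVec y y * (x.1 j)⁻¹ * ξ.1 j).trace -
          ((x.1 j)⁻¹ * ξ.1 j).trace))) / ∑ j, mixTerm y x j =
        (∑ j, (posterior y x j - weight x.2 j) * logit ξ.2 j) +
        ∑ j, posterior y x j * (1 / 2 * (((x.1 j)⁻¹ * vecMulVec y y * (x.1 j)⁻¹ * ξ.1 j).trace -
          ((x.1 j)⁻¹ * ξ.1 j).trace)) := by
      -- Uses that the posteriors sum to one.
      have e4 : ∑ j, (posterior y x j - weight x.2 j) * logit ξ.2 j =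
          ∑ j, posterior y x j * (logit ξ.2 j - ∑ l, weight x.2 l * logit ξ.2 l) := by
        simp only [sub_mul, mul_sub, Finset.sum_sub_distrib, ← Finset.sum_mul,
          sum_posterior y hx, one_mul]
      rw [e4, ← Finset.sum_add_distrib, Finset.sum_div]
      refine Finset.sum_congr rfl fun j _ => ?_
      rw [posterior]
      ring
    have e5 : ∀ j, drift p n y x j * logit ξ.2 j =
        (posterior y x j - weight x.2 j) * logit ξ.2 j +
          1 / n * (p.zeta * (1 - (k + 1) * weight x.2 j) * logit ξ.2 j) := fun j => by
      rw [drift]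
      ring
    rw [e3, e2]
    simp only [e1, e5, Finset.sum_add_distrib, ← Finset.mul_sum]
    ring

theorem metric_add_left (x v w ξ : Param d k) :
    metric x (v + w) ξ = metric x v ξ + metric x w ξ := by
  simp only [metric, Prod.fst_add, Prod.snd_add, Pi.add_apply, mul_add, add_mul, trace_add,
    Finset.sum_add_distrib]
  ring

theorem metric_smul_left (x v ξ : Param d k) (c : ℝ) :
    metric x (c • v) ξ = c * metric x v ξ := by
  simp only [metric, Prod.smul_fst, Prod.smul_snd, Pi.smul_apply, mul_smul_comm, smul_mul_assoc,
    trace_smul, smul_eq_mul, mul_add, Finset.mul_sum, mul_assoc]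

theorem metric_smul_right (x v ξ : Param d k) (c : ℝ) :
    metric x v (c • ξ) = c * metric x v ξ := by
  simp only [metric, Prod.smul_fst, Prod.smul_snd, Pi.smul_apply, mul_smul_comm,
    trace_smul, smul_eq_mul, mul_add, Finset.mul_sum]
  congr 1
  exact Finset.sum_congr rfl fun _ _ => by ring

theorem metric_add_right (x v ξ η : Param d k) :
    metric x v (ξ + η) = metric x v ξ + metric x v η := by
  simp only [metric, Prod.fst_add, Prod.snd_add, Pi.add_apply, mul_add, trace_add,
    Finset.sum_add_distrib]
  ring

theorem metric_zero_right (x v : Param d k) : metric x v 0 = 0 := by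
  simpa using metric_smul_right x v 0 0

theorem metric_sum_left {ι : Type*} (s : Finset ι) (x ξ : Param d k) (v : ι → Param d k) :
    metric x (∑ i ∈ s, v i) ξ = ∑ i ∈ s, metric x (v i) ξ :=
  map_sum (AddMonoidHom.mk' (fun v => metric x v ξ) fun v w => metric_add_left x v w ξ) v s

theorem metric_sum_right {ι : Type*} (s : Finset ι) (x v : Param d k) (ξ : ι → Param d k) :
    metric x v (∑ i ∈ s, ξ i) = ∑ i ∈ s, metric x v (ξ i) :=
  map_sum (AddMonoidHom.mk' (fun ξ => metric x v ξ) fun ξ η => metric_add_right x v ξ η) ξ s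

theorem riemGrad_eq {f : Param d k → ℝ} {x v : Param d k} (hx : x ∈ manifold d k)
    (hv : IsRiemGrad f x v) : riemGrad f x = v := by
  have h : ∃ v, IsRiemGrad f x v := ⟨v, hv⟩
  rw [riemGrad, dif_pos h]
  exact h.choose_spec.unique hx hv

theorem tangent_smul {v : Param d k} (c : ℝ) (hv : v ∈ tangent d k) : c • v ∈ tangent d k :=
  fun j => (hv j).smul c

theorem tangent_sum {ι : Type*} {s : Finset ι} {v : ι → Param d k}
    (hv : ∀ i ∈ s, v i ∈ tangent d k) : ∑ i ∈ s, v i ∈ tangent d k := by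
  intro j
  rw [Prod.fst_sum, Finset.sum_apply, IsSymm, transpose_sum]
  exact Finset.sum_congr rfl fun i hi => hv i hi j

theorem isRiemGrad_objective (p : Penalty d) (hP : p.Psi.IsSymm) (data : Fin n → Fin d → ℝ)
    {x : Param d k} (hx : x ∈ manifold d k) :
    IsRiemGrad (objective p data) x ((1 / n : ℝ) • ∑ i, componentGrad p data i x) := by
  refine ⟨tangent_smul _ (tangent_sum fun i _ => (isRiemGrad_component p hP data i hx).1),
    fun ξ hξ => ?_⟩
  rw [metric_smul_left, metric_sum_left]
  exact (HasDerivAt.fun_sum (u := Finset.univ) fun i _ =>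
    (isRiemGrad_component p hP data i hx).2 ξ hξ).const_mul _

theorem IsRiemGrad.neg {f : Param d k → ℝ} {x v : Param d k} (hv : IsRiemGrad f x v) :
    IsRiemGrad (fun x => -f x) x (-v) := by
  refine ⟨fun j => (hv.1 j).neg, fun ξ hξ => ?_⟩
  rw [← neg_one_smul ℝ v, metric_smul_left, neg_one_mul]
  exact (hv.2 ξ hξ).fun_neg

end Gradient

/-! ### A compact box invariant under every admissible step. -/

section Invariance

variable {d k n : ℕ}

/-- Completing the square with `z = (u, t)`: the form is `(α/β) uᵀΛu + κ (λ·u + t)²`. If `u = 0`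
then `t ≠ 0` and the square is positive. -/
theorem posDef_Psi (p : Penalty d) (hα : 0 < p.alpha) (hβ : 0 < p.beta) (hκ : 0 < p.kappa)
    (hLam : p.Lam.PosDef) : p.Psi.PosDef := by
  have hsymm : p.Lamᵀ = p.Lam := by simpa using hLam.1.eq
  refine PosDef.of_dotProduct_mulVec_pos ?_ fun {z} hz => ?_
  · rw [IsHermitian, conjTranspose_eq_transpose_of_trivial, Penalty.Psi, fromBlocks_transpose]
    simp only [transpose_add, transpose_smul, hsymm, transpose_vecMulVec]
    rfl
  · have e : star z ⬝ᵥ p.Psi *ᵥ z = p.alpha / p.beta * ((z ∘ Sum.inl) ⬝ᵥ p.Lam *ᵥ (z ∘ Sum.inl)) +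
        p.kappa * (p.lam ⬝ᵥ (z ∘ Sum.inl) + z (Sum.inr ())) ^ 2 := by
      have e1 : ∀ a, (vecMulVec p.lam p.lam *ᵥ (z ∘ Sum.inl)) a =
          p.lam a * (p.lam ⬝ᵥ (z ∘ Sum.inl)) := fun a => by
        simp [mulVec, vecMulVec_apply, dotProduct, Finset.mul_sum, mul_assoc]
      have e2 : (z ∘ Sum.inl) ⬝ᵥ p.lam = p.lam ⬝ᵥ (z ∘ Sum.inl) := dotProduct_comm _ _
      have e3 : star z ⬝ᵥ p.Psi *ᵥ z = (z ∘ Sum.inl) ⬝ᵥ ((p.Psi *ᵥ z) ∘ Sum.inl) +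
          z (Sum.inr ()) * (p.Psi *ᵥ z) (Sum.inr ()) := by
        simp [dotProduct, Fintype.sum_sum_type]
      have e4 : (p.Psi *ᵥ z) ∘ Sum.inl = (p.alpha / p.beta) • (p.Lam *ᵥ (z ∘ Sum.inl)) +
          (p.kappa * (p.lam ⬝ᵥ (z ∘ Sum.inl) + z (Sum.inr ()))) • p.lam := by
        rw [Penalty.Psi, fromBlocks_mulVec]
        funext a
        simp only [Function.comp_apply, Sum.elim_inl, Pi.add_apply, add_mulVec, smul_mulVec,
          Pi.smul_apply, smul_eq_mul, e1]
        simp [mulVec, dotProduct]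
        ring
      have e5 : (p.Psi *ᵥ z) (Sum.inr ()) =
          p.kappa * (p.lam ⬝ᵥ (z ∘ Sum.inl) + z (Sum.inr ())) := by
        rw [Penalty.Psi, fromBlocks_mulVec]
        simp [mulVec, dotProduct, Finset.mul_sum, mul_add, mul_assoc]
      rw [e3, e4, e5, dotProduct_add, dotProduct_smul, dotProduct_smul, e2]
      simp only [smul_eq_mul]
      ring
    rw [e]
    by_cases h0 : z ∘ Sum.inl = 0
    · have h1 : z (Sum.inr ()) ≠ 0 := fun h => hz (by
        funext a
        rcases a with a | a
        · exact congrFun h0 a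
        · exact h)
      rw [h0]
      simp only [mulVec_zero, dotProduct_zero, mul_zero, zero_add]
      positivity
    · have h1 := hLam.dotProduct_mulVec_pos h0
      simp only [star_trivial] at h1
      positivity

theorem step_fst (p : Penalty d) (data : Fin n → Fin d → ℝ) (i : Fin n) (x : Param d k) (η : ℝ)
    (j : Fin (k + 1)) :
    (retr x (η • componentGrad p data i x)).1 j =
      (1 - η / 2 * (posterior (augment (data i)) x j + p.rho / n)) • x.1 j +
        (η / 2) • (posterior (augment (data i)) x j •
          vecMulVec (augment (data i)) (augment (data i)) + (p.beta / n) • p.Psi) := by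
  simp only [retr, componentGrad, Prod.fst_add, Prod.smul_fst, Pi.add_apply, Pi.smul_apply]
  module

theorem step_snd (p : Penalty d) (data : Fin n → Fin d → ℝ) (i : Fin n) (x : Param d k) (η : ℝ)
    (l : Fin k) :
    (retr x (η • componentGrad p data i x)).2 l =
      x.2 l + η * drift p n (augment (data i)) x l.castSucc := rfl

theorem posSemidef_step (p : Penalty d) (data : Fin n → Fin d → ℝ) (i : Fin n) {x : Param d k}
    {η c c₀ : ℝ} (hβ : 0 < p.beta) (hρ : 0 < p.rho) (hη : 0 ≤ η) (hη2 : η * (1 + p.rho / n) ≤ 2)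
    (hΨ : (p.Psi - c₀ • 1).PosSemidef) (hc : 0 < c)
    (hcc : c * (1 + p.rho / n) ≤ p.beta / n * c₀) (hx : x ∈ manifold d k) (j : Fin (k + 1))
    (hxc : (x.1 j - c • 1).PosSemidef) :
    ((retr x (η • componentGrad p data i x)).1 j - c • 1).PosSemidef := by
  rw [step_fst]
  set y := augment (data i)
  set h := posterior y x j
  have h0 : 0 ≤ h := posterior_nonneg y hx j
  have h1 : h ≤ 1 := posterior_le_one y hx j
  have hr : 0 ≤ p.rho / n := by positivity
  -- Admissibility enters here: as `h ≤ 1`, the old matrix keeps a nonnegative coefficient.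
  have ha : η / 2 * (h + p.rho / n) ≤ 1 := by nlinarith
  have hb : 0 ≤ η / 2 * (p.beta / n * c₀ - (h + p.rho / n) * c) :=
    mul_nonneg (by linarith) (by nlinarith)
  have e : (1 - η / 2 * (h + p.rho / n)) • x.1 j +
      (η / 2) • (h • vecMulVec y y + (p.beta / n) • p.Psi) - c • 1 =
      (1 - η / 2 * (h + p.rho / n)) • (x.1 j - c • 1) + (η / 2 * h) • vecMulVec y y +
        (η / 2 * (p.beta / n)) • (p.Psi - c₀ • 1) +
        (η / 2 * (p.beta / n * c₀ - (h + p.rho / n) * c)) • (1 : Matrix (Idx d) (Idx d) ℝ) := by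
    module
  rw [e]
  have hy : (vecMulVec y y).PosSemidef := by simpa using posSemidef_vecMulVec_self_star y
  exact (((hxc.smul (sub_nonneg.2 ha)).add (hy.smul (by positivity))).add
    (hΨ.smul (by positivity))).add (PosSemidef.one.smul hb)

theorem trace_step_le (p : Penalty d) (data : Fin n → Fin d → ℝ) (i : Fin n) {x : Param d k}
    {η M : ℝ} (hρ : 0 < p.rho) (hη : 0 ≤ η) (hη2 : η * (1 + p.rho / n) ≤ 2)
    (hMy : augment (data i) ⬝ᵥ augment (data i) ≤ M) (hMΨ : p.beta / n * p.Psi.trace ≤ p.rho / n * M)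
    (hx : x ∈ manifold d k) (j : Fin (k + 1)) (hxM : (x.1 j).trace ≤ M) :
    ((retr x (η • componentGrad p data i x)).1 j).trace ≤ M := by
  rw [step_fst]
  set y := augment (data i)
  set h := posterior y x j
  have h0 : 0 ≤ h := posterior_nonneg y hx j
  have h1 : h ≤ 1 := posterior_le_one y hx j
  have hr : 0 ≤ p.rho / n := by positivity
  have ha : 0 ≤ 1 - η / 2 * (h + p.rho / n) := by nlinarith
  simp only [trace_add, trace_smul, trace_vecMulVec, smul_eq_mul]
  calc _ ≤ (1 - η / 2 * (h + p.rho / n)) * M + η / 2 * (h * M + p.rho / n * M) := by gcongr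
    _ = M := by ring

theorem le_drift (p : Penalty d) (y : Idx d → ℝ) {x : Param d k} (hx : x ∈ manifold d k)
    (j : Fin (k + 1)) :
    p.zeta / n - (1 + p.zeta / n * (k + 1)) * weight x.2 j ≤ drift p n y x j := by
  have := posterior_nonneg y hx j
  rw [drift]
  linarith

/-- Posteriors and weights both sum to one, so the drifts over all `K` components cancel; a lower
bound for the last one is an upper bound for the rest. -/
theorem sum_drift_le (p : Penalty d) (y : Idx d → ℝ) {x : Param d k} (hx : x ∈ manifold d k) :
    ∑ l : Fin k, drift p n y x l.castSucc ≤
      (1 + p.zeta / n * (k + 1)) * weight x.2 (Fin.last k) - p.zeta / n := by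
  have h : ∑ j, drift p n y x j = 0 := by
    simp only [drift, Finset.sum_add_distrib, Finset.sum_sub_distrib, ← Finset.mul_sum,
      sum_posterior y hx, sum_weight]
    simp
  rw [Fin.sum_univ_castSucc] at h
  have := le_drift (n := n) p y hx (Fin.last k)
  linarith

theorem le_step_snd (p : Penalty d) (data : Fin n → Fin d → ℝ) (i : Fin n) {x : Param d k}
    {η a : ℝ} (hζ : 0 < p.zeta) (hη : 0 ≤ η) (hη2 : η ≤ 2)
    (ha : a ≤ Real.log (p.zeta / n / (1 + p.zeta / n * (k + 1))) -
      2 * (1 + p.zeta / n * (k + 1))) (hx : x ∈ manifold d k) (l : Fin k) (hxa : a ≤ x.2 l) :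
    a ≤ (retr x (η • componentGrad p data i x)).2 l := by
  have hn : (0 : ℝ) < n := by exact_mod_cast i.pos
  rw [step_snd]
  set z := p.zeta / n with hz
  have hz0 : 0 < z := by positivity
  set A := 1 + z * (k + 1) with hA
  have hA0 : 0 < A := by positivity
  have hd := le_drift (n := n) p (augment (data i)) hx l.castSucc
  rw [← hz, ← hA] at hd
  set D := drift p n (augment (data i)) x l.castSucc
  -- With `D ≥ z - A α_l`, the threshold is `α_l = z / A`. Below it the coordinate cannot decrease;
  -- above `log (z / A)` one step loses at most `2 A`.
  rcases le_total (x.2 l) (Real.log (z / A)) with h | h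
  · have h1 : weight x.2 l.castSucc ≤ z / A :=
      (weight_castSucc_le x.2 l).trans ((Real.le_log_iff_exp_le (by positivity)).1 h)
    have h2 : 0 ≤ D := by
      rw [le_div_iff₀ hA0] at h1
      linarith
    nlinarith
  · have h1 := weight_le_one x.2 l.castSucc
    have h2 : -A ≤ D := by nlinarith
    nlinarith

theorem sum_step_snd_le (p : Penalty d) (data : Fin n → Fin d → ℝ) (i : Fin n) {x : Param d k}
    {η b : ℝ} (hζ : 0 < p.zeta) (hη : 0 ≤ η) (hη2 : η ≤ 2)
    (hb : k * -Real.log (p.zeta / n / (1 + p.zeta / n * (k + 1))) +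
      2 * (1 + p.zeta / n * (k + 1)) ≤ b) (hx : x ∈ manifold d k) (hxb : ∑ l, x.2 l ≤ b) :
    ∑ l, (retr x (η • componentGrad p data i x)).2 l ≤ b := by
  have hn : (0 : ℝ) < n := by exact_mod_cast i.pos
  simp only [step_snd, Finset.sum_add_distrib, ← Finset.mul_sum]
  have hd := sum_drift_le (n := n) p (augment (data i)) hx
  set z := p.zeta / n with hz
  have hz0 : 0 < z := by positivity
  set A := 1 + z * (k + 1) with hA
  have hA0 : 0 < A := by positivity
  set D := ∑ l : Fin k, drift p n (augment (data i)) x l.castSucc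
  rcases le_total (weight x.2 (Fin.last k)) (z / A) with h | h
  · have h2 : D ≤ 0 := by
      rw [le_div_iff₀ hA0] at h
      linarith
    nlinarith
  · have h1 := weight_le_one x.2 (Fin.last k)
    have h2 : D ≤ A := by nlinarith
    -- A last weight of at least `z / A` forces every `ω_l ≤ -log (z / A)`, so the sum is far enough
    -- below `b` to absorb one step.
    have h3 : ∑ l, x.2 l ≤ ∑ l : Fin k, -Real.log (z / A) := Finset.sum_le_sum fun l _ => by
      have h4 := (Real.log_le_iff_le_exp (by positivity)).2 (h.trans (weight_last_le x.2 l))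
      linarith
    rw [Finset.sum_const, Finset.card_univ, Fintype.card_fin, nsmul_eq_mul] at h3
    nlinarith

theorem exists_invariant_box (p : Penalty d) (data : Fin n → Fin d → ℝ) (hn : 0 < n)
    (hβ : 0 < p.beta) (hζ : 0 < p.zeta) (hρ : 0 < p.rho) (hΨ : p.Psi.PosDef)
    {x₀ : Param d k} (hx₀ : x₀ ∈ manifold d k) :
    ∃ (c M : ℝ) (a : Fin k → ℝ) (b : ℝ), 0 < c ∧ x₀ ∈ box c M a b ∧
      ∀ η : ℝ, 0 ≤ η → η * (1 + p.rho / n) ≤ 2 → ∀ i, ∀ x ∈ box c M a b,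
        retr x (η • componentGrad p data i x) ∈ box c M a b := by
  have hn' : (0 : ℝ) < n := by exact_mod_cast hn
  have hr : 0 < p.rho / n := by positivity
  obtain ⟨c₀, hc₀, hΨc⟩ := exists_pos_posSemidef_sub hΨ
  choose cs hcs hcs' using fun j => exists_pos_posSemidef_sub (hx₀ j)
  obtain ⟨j₀, hj₀⟩ := Finite.exists_min cs
  obtain ⟨i₁, hi₁⟩ : ∃ i, ∀ i', augment (data i') ⬝ᵥ augment (data i') ≤
      augment (data i) ⬝ᵥ augment (data i) := by
    have : Nonempty (Fin n) := ⟨⟨0, hn⟩⟩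
    exact Finite.exists_max _
  obtain ⟨j₁, hj₁⟩ := Finite.exists_max fun j => (x₀.1 j).trace
  -- Each bound is the weaker of what `x₀` requires and what one step preserves; none involves `η`.
  set c := min (cs j₀) (p.beta / n * c₀ / (1 + p.rho / n)) with hc
  have hc0 : 0 < c := lt_min (hcs j₀) (by positivity)
  set M := max (augment (data i₁) ⬝ᵥ augment (data i₁))
    (max (x₀.1 j₁).trace (p.beta / n * p.Psi.trace / (p.rho / n))) with hM
  set A := 1 + p.zeta / n * (k + 1) with hA
  set e := Real.log (p.zeta / n / A) with he
  refine ⟨c, M, fun l => min (x₀.2 l) (e - 2 * A), max (∑ l, x₀.2 l) (k * -e + 2 * A), hc0,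
    ⟨fun j => ?_, fun j => (hj₁ j).trans ((le_max_left _ _).trans (le_max_right _ _)),
      fun l => min_le_left _ _, le_max_left _ _⟩, fun η hη hη2 i x hx => ?_⟩
  · rw [show x₀.1 j - c • (1 : Matrix (Idx d) (Idx d) ℝ) =
      (x₀.1 j - cs j • 1) + (cs j - c) • (1 : Matrix (Idx d) (Idx d) ℝ) by module]
    exact (hcs' j).add (PosSemidef.one.smul (sub_nonneg.2 ((min_le_left _ _).trans (hj₀ j))))
  · have hxm := box_subset_manifold hc0 hx
    have hη3 : η ≤ 2 := by nlinarith
    have hcc : c * (1 + p.rho / n) ≤ p.beta / n * c₀ := by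
      rw [← le_div_iff₀ (by positivity)]
      exact min_le_right _ _
    have hMΨ : p.beta / n * p.Psi.trace ≤ p.rho / n * M := by
      rw [mul_comm (p.rho / n), ← div_le_iff₀ hr]
      exact (le_max_right _ _).trans (le_max_right _ _)
    exact ⟨fun j => posSemidef_step p data i hβ hρ hη hη2 hΨc hc0 hcc hxm j (hx.1 j),
      fun j => trace_step_le p data i hρ hη hη2 ((hi₁ i).trans (le_max_left _ _)) hMΨ hxm j
        (hx.2.1 j),
      fun l => le_step_snd p data i hζ hη hη3 (min_le_right _ _) hxm l (hx.2.2.1 l),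
      sum_step_snd_le p data i hζ hη hη3 (le_max_right _ _) hxm hx.2.2.2⟩

end Invariance

/-! ### Taylor bounds on convex compact sets. -/

section QuadraticBound

variable {E : Type*} [NormedAddCommGroup E] [NormedSpace ℝ E]

theorem exists_norm_fderiv_le {f : E → ℝ} {U C : Set E} (hU : IsOpen U)
    (hf : ContDiffOn ℝ 2 f U) (hC : IsCompact C) (hCU : C ⊆ U) :
    ∃ B, 0 ≤ B ∧ ∀ x ∈ C, ‖fderiv ℝ f x‖ ≤ B := by
  have h1 : ContDiffOn ℝ 1 (fderiv ℝ f) U := hf.fderiv_of_isOpen hU (by norm_num)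
  obtain ⟨B, hB⟩ := hC.exists_bound_of_continuousOn (h1.continuousOn.mono hCU)
  exact ⟨max B 0, le_max_right _ _, fun x hx => (hB x hx).trans (le_max_left _ _)⟩

/-- The mean value inequality is applied twice: to `fderiv ℝ f`, which is thereby Lipschitz on `C`,
and to `f` along the segment. Convexity of `C` keeps the segment inside. -/
theorem exists_quadratic_bound {f : E → ℝ} {U C : Set E} (hU : IsOpen U)
    (hf : ContDiffOn ℝ 2 f U) (hC : IsCompact C) (hconv : Convex ℝ C) (hCU : C ⊆ U) :
    ∃ B, 0 ≤ B ∧ ∀ x ∈ C, ∀ y ∈ C, |f y - f x - fderiv ℝ f x (y - x)| ≤ B * ‖y - x‖ ^ 2 := by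
  have h1 : ContDiffOn ℝ 1 (fderiv ℝ f) U := hf.fderiv_of_isOpen hU (by norm_num)
  have h2 : ContinuousOn (fderiv ℝ (fderiv ℝ f)) U :=
    (h1.fderiv_of_isOpen (m := 0) hU (by norm_num)).continuousOn
  obtain ⟨B, hB⟩ := hC.exists_bound_of_continuousOn (f := fderiv ℝ (fderiv ℝ f)) (h2.mono hCU)
  refine ⟨max B 0, le_max_right _ _, fun x hx y hy => ?_⟩
  have hd : ∀ z ∈ C, HasFDerivWithinAt f (fderiv ℝ f z) C z := fun z hz =>
    ((hf.differentiableOn (by norm_num)).differentiableAt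
      (hU.mem_nhds (hCU hz))).hasFDerivAt.hasFDerivWithinAt
  have hd2 : ∀ z ∈ C, HasFDerivWithinAt (fderiv ℝ f) (fderiv ℝ (fderiv ℝ f) z) C z :=
    fun z hz => ((h1.differentiableOn (by norm_num)).differentiableAt
      (hU.mem_nhds (hCU hz))).hasFDerivAt.hasFDerivWithinAt
  have hseg : segment ℝ x y ⊆ C := hconv.segment_subset hx hy
  have hlip : ∀ z ∈ segment ℝ x y, ‖fderiv ℝ f z - fderiv ℝ f x‖ ≤ max B 0 * ‖y - x‖ := by
    intro z hz
    refine (hconv.norm_image_sub_le_of_norm_hasFDerivWithin_le hd2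
      (fun w hw => (hB w hw).trans (le_max_left B 0)) hx (hseg hz)).trans ?_
    gcongr
    exact norm_sub_le_of_mem_segment hz
  have h := (convex_segment x y).norm_image_sub_le_of_norm_hasFDerivWithin_le'
    (fun z hz => (hd z (hseg hz)).mono hseg) hlip (left_mem_segment ℝ x y)
    (right_mem_segment ℝ x y)
  rw [Real.norm_eq_abs] at h
  calc _ ≤ _ := h
    _ = _ := by ring

end QuadraticBound

/-! ### Smoothness of the objective and existence of valid constants. -/

section Smoothness

open scoped Matrix.Norms.Elementwise

variable {d k n : ℕ}

theorem contDiff_det {E : Type*} [NormedAddCommGroup E] [NormedSpace ℝ E] {m : Type*} [Fintype m]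
    [DecidableEq m] {A : E → Matrix m m ℝ} (hA : ∀ i j, ContDiff ℝ 2 fun x => A x i j) :
    ContDiff ℝ 2 fun x => (A x).det := by
  simp_rw [det_apply']
  exact ContDiff.sum fun σ _ => contDiff_const.mul (contDiff_prod fun i _ => hA _ _)

theorem contDiff_adjugate_apply {E : Type*} [NormedAddCommGroup E] [NormedSpace ℝ E] {m : Type*}
    [Fintype m] [DecidableEq m] {A : E → Matrix m m ℝ}
    (hA : ∀ i j, ContDiff ℝ 2 fun x => A x i j) (i j : m) :
    ContDiff ℝ 2 fun x => (A x).adjugate i j := by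
  simp_rw [adjugate_apply]
  refine contDiff_det fun r s => ?_
  by_cases h : r = j
  · subst h
    simp only [updateRow_self]
    exact contDiff_const
  · simp only [updateRow_ne h]
    exact hA r s

theorem contDiff_entry (j : Fin (k + 1)) (r s : Idx d) :
    ContDiff ℝ 2 fun x : Param d k => x.1 j r s := by
  have h : ContDiff ℝ 2 fun x : Param d k => x.1 j := contDiff_pi.1 contDiff_fst j
  have h1 : ContDiff ℝ 2 fun x : Param d k => x.1 j r := contDiff_pi.1 h r
  exact contDiff_pi.1 h1 s

/-- The set of parameters with covariances of positive determinant. -/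
def detPos (d k : ℕ) : Set (Param d k) := {x | ∀ j, 0 < (x.1 j).det}

theorem isOpen_detPos : IsOpen (detPos d k) := by
  simp only [detPos, Set.ofPred_forall]
  exact isOpen_iInter_of_finite fun j => isOpen_lt continuous_const (by fun_prop)

theorem manifold_subset_detPos : manifold d k ⊆ detPos d k := fun _ hx => manifold_det_pos hx

theorem contDiffOn_log_det (j : Fin (k + 1)) :
    ContDiffOn ℝ 2 (fun x : Param d k => Real.log (x.1 j).det) (detPos d k) :=
  (contDiff_det (contDiff_entry j)).contDiffOn.log fun _ hx => (hx j).ne'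

theorem contDiffOn_trace_mul_inv (W : Matrix (Idx d) (Idx d) ℝ) (j : Fin (k + 1)) :
    ContDiffOn ℝ 2 (fun x : Param d k => (W * (x.1 j)⁻¹).trace) (detPos d k) := by
  -- Cramer's rule: the entries of the inverse are polynomials divided by the determinant.
  have h : ContDiffOn ℝ 2 (fun x : Param d k =>
      ∑ r, ∑ s, W r s * (((x.1 j).det)⁻¹ * (x.1 j).adjugate s r)) (detPos d k) :=
    ContDiffOn.sum fun r _ => ContDiffOn.sum fun s _ => contDiffOn_const.mul
      (((contDiff_det (contDiff_entry j)).contDiffOn.inv fun _ hx => (hx j).ne').mul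
        (contDiff_adjugate_apply (contDiff_entry j) s r).contDiffOn)
  refine h.congr fun x hx => ?_
  simp only [trace, diag_apply, mul_apply, inv_def, Matrix.smul_apply, smul_eq_mul, Ring.inverse_eq_inv']

theorem contDiff_log_weight (j : Fin (k + 1)) :
    ContDiff ℝ 2 (fun x : Param d k => Real.log (weight x.2 j)) := by
  have hl : ∀ j, ContDiff ℝ 2 fun x : Param d k => logit x.2 j := fun j => by
    induction j using Fin.lastCases with
    | last => simpa using contDiff_const
    | cast l => simpa using contDiff_pi.1 (contDiff_snd (E := Fin (k + 1) → Matrix _ _ ℝ)) l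
  simp_rw [log_weight]
  exact (hl j).sub ((ContDiff.sum fun l _ => (hl l).exp).log fun x => (sum_exp_pos x.2).ne')

theorem contDiffOn_mixTerm (y : Idx d → ℝ) (j : Fin (k + 1)) :
    ContDiffOn ℝ 2 (fun x : Param d k => mixTerm y x j) (detPos d k) := by
  have h : ContDiffOn ℝ 2 (fun x : Param d k =>
      Real.exp (Real.log (weight x.2 j) + logQ y (x.1 j))) (detPos d k) :=
    ((contDiff_log_weight j).contDiffOn.add ((contDiffOn_const.sub
      (contDiffOn_const.mul (contDiffOn_log_det j))).sub
        (contDiffOn_const.mul (contDiffOn_trace_mul_inv _ j)))).exp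
  exact h.congr fun x hx => mixTerm_eq_exp y (hx j)

theorem contDiffOn_component (p : Penalty d) (data : Fin n → Fin d → ℝ) (i : Fin n) :
    ContDiffOn ℝ 2 (component p data i : Param d k → ℝ) (detPos d k) := by
  refine ((ContDiffOn.sum fun j _ => contDiffOn_mixTerm (augment (data i)) j).log
    fun x hx => (sum_mixTerm_pos _ hx).ne').add (contDiffOn_const.mul
      ((ContDiffOn.sum fun j _ => ?_).add (contDiffOn_const.mul
        (ContDiff.sum fun j _ => contDiff_log_weight j).contDiffOn)))
  exact (contDiffOn_const.mul (contDiffOn_log_det j)).sub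
    (contDiffOn_const.mul (contDiffOn_trace_mul_inv _ j))

theorem contDiffOn_objective (p : Penalty d) (data : Fin n → Fin d → ℝ) :
    ContDiffOn ℝ 2 (objective p data : Param d k → ℝ) (detPos d k) :=
  contDiffOn_const.mul (ContDiffOn.sum fun i _ => contDiffOn_component p data i)

theorem fderiv_eq_metric {f : Param d k → ℝ} (hf : ContDiffOn ℝ 2 f (detPos d k))
    {x v ξ : Param d k} (hx : x ∈ manifold d k) (hv : IsRiemGrad f x v) (hξ : ξ ∈ tangent d k) :
    fderiv ℝ f x ξ = metric x v ξ := by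
  have h := (((hf.differentiableOn (by norm_num)).differentiableAt
    (isOpen_detPos.mem_nhds (manifold_subset_detPos hx))).hasFDerivAt.hasLineDerivAt ξ)
  exact HasDerivAt.unique h (hv.2 ξ hξ)

theorem continuousOn_metric :
    ContinuousOn (fun q : Param d k × Param d k => metric q.1 q.2 q.2)
      (manifold d k ×ˢ Set.univ) := by
  have hinv : ∀ j, ContinuousOn (fun q : Param d k × Param d k => (q.1.1 j)⁻¹)
      (manifold d k ×ˢ Set.univ) := fun j q hq => by
    have h1 : ContinuousAt (fun A : Matrix (Idx d) (Idx d) ℝ => A⁻¹) (q.1.1 j) := by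
      refine continuousAt_matrix_inv _ ?_
      rw [Ring.inverse_eq_inv']
      exact continuousAt_inv₀ (manifold_det_pos hq.1 j).ne'
    exact (h1.comp (f := fun q : Param d k × Param d k => q.1.1 j)
      (by fun_prop)).continuousWithinAt
  have hid : ∀ j, ContinuousOn (fun q : Param d k × Param d k => q.2.1 j)
      (manifold d k ×ˢ Set.univ) := fun j => by fun_prop
  refine ContinuousOn.add (continuousOn_finsetSum _ fun j _ => ?_) (by fun_prop)
  exact (continuous_id.matrix_trace).comp_continuousOn
    ((((hinv j).mul (hid j)).mul (hinv j)).mul (hid j))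

theorem isClosed_tangent : IsClosed (tangent d k) := by
  simp only [tangent, Set.ofPred_forall, IsSymm]
  exact isClosed_iInter fun j => isClosed_eq (by fun_prop) (by fun_prop)

/-- The metric is continuous and positive on the compact product of `C` with the unit sphere of the
tangent space; homogeneity extends the bound to all tangent vectors. -/
theorem exists_norm_sq_le_metric {C : Set (Param d k)} (hC : IsCompact C)
    (hCm : C ⊆ manifold d k) :
    ∃ A, 0 ≤ A ∧ ∀ x ∈ C, ∀ ξ ∈ tangent d k, ‖ξ‖ ^ 2 ≤ A * metric x ξ ξ := by
  have : ProperSpace (Param d k) := FiniteDimensional.proper ℝ _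
  set K : Set (Param d k × Param d k) :=
    C ×ˢ (Metric.sphere (0 : Param d k) 1 ∩ tangent d k) with hK
  have hKc : IsCompact K := hC.prod ((isCompact_sphere _ _).inter_right isClosed_tangent)
  have hKm : K ⊆ manifold d k ×ˢ Set.univ := Set.prod_mono hCm (Set.subset_univ _)
  have hpos : ∀ q ∈ K, 0 < metric q.1 q.2 q.2 := fun q hq => by
    refine lt_of_le_of_ne (metric_self_nonneg (hCm hq.1) hq.2.2) fun h => ?_
    have h0 := eq_zero_of_metric_self (hCm hq.1) hq.2.2 h.symm
    have h1 := hq.2.1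
    rw [h0] at h1
    simp at h1
  obtain ⟨B, hB⟩ := hKc.exists_bound_of_continuousOn
    ((continuousOn_metric.mono hKm).inv₀ fun q hq => (hpos q hq).ne')
  refine ⟨max B 0, le_max_right _ _, fun x hx ξ hξ => ?_⟩
  rcases eq_or_ne ξ 0 with rfl | h0
  · simp [metric_zero_right]
  · have hn : 0 < ‖ξ‖ := norm_pos_iff.2 h0
    have hq : (x, ‖ξ‖⁻¹ • ξ) ∈ K := by
      refine ⟨hx, ?_, tangent_smul _ hξ⟩
      rw [mem_sphere_zero_iff_norm, norm_smul, norm_inv, norm_norm, inv_mul_cancel₀ hn.ne']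
    have h1 := (le_abs_self _).trans (hB _ hq)
    have h2 := hpos _ hq
    simp only [Pi.inv_apply, metric_smul_left, metric_smul_right] at h1 h2
    set g := metric x ξ ξ
    have hg : 0 < g := by
      have h3 := pos_of_mul_pos_right h2 (by positivity)
      exact pos_of_mul_pos_right h3 (by positivity)
    have h3 : ‖ξ‖ ^ 2 / g ≤ B := by
      refine le_trans (le_of_eq ?_) h1
      field_simp
    rw [div_le_iff₀ hg] at h3
    exact h3.trans (by gcongr; exact le_max_left _ _)

theorem riemNorm_sq {x v : Param d k} (hx : x ∈ manifold d k) (hv : v ∈ tangent d k) :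
    riemNorm x v ^ 2 = metric x v v := Real.sq_sqrt (metric_self_nonneg hx hv)

theorem exists_gradBoundedOn (p : Penalty d) (hP : p.Psi.IsSymm) (data : Fin n → Fin d → ℝ)
    {C : Set (Param d k)} (hC : IsCompact C) (hCm : C ⊆ manifold d k) :
    ∃ G, GradBoundedOn (component p data) C G := by
  obtain ⟨A, hA0, hA⟩ := exists_norm_sq_le_metric hC hCm
  choose B hB0 hB using fun i => exists_norm_fderiv_le isOpen_detPos
    (contDiffOn_component p data i) hC (hCm.trans manifold_subset_detPos)
  refine ⟨∑ i, B i * √A, fun x hx i => ?_⟩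
  refine le_trans ?_ (Finset.single_le_sum (f := fun i => B i * √A)
    (fun i _ => mul_nonneg (hB0 i) (Real.sqrt_nonneg _)) (Finset.mem_univ i))
  have hg := isRiemGrad_component p hP data i (hCm hx)
  rw [riemGrad_eq (hCm hx) hg]
  set v := componentGrad p data i x
  have h1 : ‖v‖ ≤ √A * riemNorm x v := by
    rw [riemNorm, ← Real.sqrt_mul hA0]
    exact Real.le_sqrt_of_sq_le (hA x hx v hg.1)
  -- Evaluating the differential at the gradient itself gives `‖v‖_x² = Df(x) v`; one factor `‖v‖_x`
  -- is cancelled below.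
  have h2 : riemNorm x v ^ 2 ≤ B i * √A * riemNorm x v := by
    rw [riemNorm_sq (hCm hx) hg.1,
      ← fderiv_eq_metric (contDiffOn_component p data i) (hCm hx) hg hg.1]
    calc _ ≤ ‖fderiv ℝ (component p data i) x v‖ := le_abs_self _
      _ ≤ B i * ‖v‖ := (ContinuousLinearMap.le_opNorm _ _).trans (by gcongr; exact hB i x hx)
      _ ≤ B i * (√A * riemNorm x v) := by gcongr; exact hB0 i
      _ = _ := by ring
  have h3 : 0 ≤ riemNorm x v := Real.sqrt_nonneg _
  rcases h3.eq_or_lt with h | h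
  · rw [← h]
    exact mul_nonneg (hB0 i) (Real.sqrt_nonneg _)
  · nlinarith

theorem exists_lipschitzGrowthOn (p : Penalty d) (hP : p.Psi.IsSymm) (data : Fin n → Fin d → ℝ)
    {C : Set (Param d k)} (hC : IsCompact C) (hconv : Convex ℝ C) (hCm : C ⊆ manifold d k) :
    ∃ L, 0 ≤ L ∧ LipschitzGrowthOn (fun x => -objective p data x) C L := by
  obtain ⟨A, hA0, hA⟩ := exists_norm_sq_le_metric hC hCm
  obtain ⟨B, hB0, hB⟩ := exists_quadratic_bound isOpen_detPos
    (contDiffOn_objective p data).neg hC hconv (hCm.trans manifold_subset_detPos)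
  -- The factor `2` cancels the `1/2` in the growth bound; `A` converts the ambient norm to the
  -- metric.
  refine ⟨2 * (B * A), by positivity, fun x hx ξ hξ hξC => ?_⟩
  have hg := (isRiemGrad_objective p hP data (hCm hx)).neg
  have h1 := (le_abs_self _).trans (hB x hx _ hξC)
  rw [riemGrad_eq (hCm hx) hg, riemNorm_sq (hCm hx) hξ]
  have hm := fderiv_eq_metric (contDiffOn_objective p data).neg (hCm hx) hg hξ
  have h2 : retr x ξ - x = ξ := add_sub_cancel_left x ξ
  have h3 := mul_le_mul_of_nonneg_left (hA x hx ξ hξ) hB0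
  have h4 : -objective p data (retr x ξ) - -objective p data x -
      metric x (-((1 / n : ℝ) • ∑ i, componentGrad p data i x)) ξ ≤ B * (A * metric x ξ ξ) := by
    rw [← hm]
    rw [h2] at h1
    exact h1.trans h3
  linarith

end Smoothness

/-! ### Coercivity and existence of a maximum. -/

section Coercivity

/-- The bound on the contribution of an eigenvalue `exp u` of a covariance to the objective. -/
noncomputable def eigenBound (r s u : ℝ) : ℝ := 1 / 2 * max 0 (-u) - r * u - s * Real.exp (-u)

theorem eigenBound_le_of_nonpos {r s u : ℝ} (hs : 0 < s) (hu : u ≤ 0) :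
    eigenBound r s u ≤ (1 / 2 + r) * -u - s / 2 * u ^ 2 := by
  have h := Real.quadratic_le_exp_of_nonneg (neg_nonneg.2 hu)
  rw [eigenBound, max_eq_right (neg_nonneg.2 hu)]
  nlinarith

theorem eigenBound_le_of_nonneg {r s u : ℝ} (hs : 0 < s) (hu : 0 ≤ u) :
    eigenBound r s u ≤ -(r * u) := by
  rw [eigenBound, max_eq_left (neg_nonpos.2 hu)]
  have := Real.exp_pos (-u)
  nlinarith

/-- For `u ≤ 0` the constant is the maximum over `v = -u` of `(1/2 + r) v - (s/2) v²`. -/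
theorem eigenBound_le {r s : ℝ} (hr : 0 < r) (hs : 0 < s) (u : ℝ) :
    eigenBound r s u ≤ (1 / 2 + r) ^ 2 / (2 * s) := by
  rcases le_total 0 u with hu | hu
  · have h : 0 ≤ (1 / 2 + r) ^ 2 / (2 * s) := by positivity
    have := eigenBound_le_of_nonneg (r := r) hs hu
    nlinarith
  · refine (eigenBound_le_of_nonpos hs hu).trans ?_
    rw [le_div_iff₀ (by positivity)]
    nlinarith [sq_nonneg (1 / 2 + r + s * u)]

theorem exists_abs_le_of_le_eigenBound {r s : ℝ} (hr : 0 < r) (hs : 0 < s) {R : ℝ} (hR : 0 ≤ R) :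
    ∃ U, ∀ u, -R ≤ eigenBound r s u → |u| ≤ U := by
  -- The first bound serves `u ≥ 0`. For `u ≤ 0`, exceeding the second makes the quadratic term beat
  -- `(1/2 + r + R)(-u)`, and `-u > 1` then forces a value below `-R`.
  refine ⟨max (R / r) (1 + 2 * (1 / 2 + r + R) / s), fun u hu => ?_⟩
  rcases le_total 0 u with h | h
  · rw [abs_of_nonneg h]
    refine le_trans ?_ (le_max_left _ _)
    rw [le_div_iff₀ hr]
    linarith [eigenBound_le_of_nonneg (r := r) hs h]
  · rw [abs_of_nonpos h]
    refine le_trans ?_ (le_max_right _ _)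
    have h1 := eigenBound_le_of_nonpos (r := r) hs h
    by_contra! h2
    have h3 : 1 < -u := lt_of_le_of_lt (le_add_of_nonneg_right (by positivity)) h2
    have h4 : 2 * (1 / 2 + r + R) < s * -u := by
      have : 2 * (1 / 2 + r + R) / s < -u := by linarith
      rw [div_lt_iff₀ hs] at this
      linarith
    nlinarith

variable {d k n : ℕ}

/-- The bound on the contribution of a covariance to the objective. -/
noncomputable def covBound (p : Penalty d) (n : ℕ) (S : Matrix (Idx d) (Idx d) ℝ) : ℝ :=
  1 / 2 * max 0 (-Real.log S.det) + 1 / n * p.psi S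

theorem logQ_le (y : Idx d → ℝ) {S : Matrix (Idx d) (Idx d) ℝ} (hS : S.PosDef) :
    logQ y S ≤ logConst d + 1 / 2 * max 0 (-Real.log S.det) := by
  have hy : (vecMulVec y y).PosSemidef := by simpa using posSemidef_vecMulVec_self_star y
  have h := trace_mul_nonneg hy hS.inv.posSemidef
  have h2 := le_max_right 0 (-Real.log S.det)
  rw [logQ]
  linarith

/-- A weighted average is at most the largest density. Truncation at zero lets the sum over
components dominate each single one. -/
theorem log_sum_mixTerm_le (y : Idx d → ℝ) {x : Param d k} (hx : x ∈ manifold d k) :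
    Real.log (∑ j, mixTerm y x j) ≤
      logConst d + ∑ j, 1 / 2 * max 0 (-Real.log (x.1 j).det) := by
  rw [Real.log_le_iff_le_exp (sum_mixTerm_pos y (manifold_det_pos hx))]
  set B := logConst d + ∑ j, 1 / 2 * max 0 (-Real.log (x.1 j).det) with hB
  calc ∑ j, mixTerm y x j ≤ ∑ j, weight x.2 j * Real.exp B := by
        refine Finset.sum_le_sum fun j _ => ?_
        rw [mixTerm, qN_eq_exp y (manifold_det_pos hx j)]
        refine mul_le_mul_of_nonneg_left (Real.exp_le_exp.2 ((logQ_le y (hx j)).trans ?_))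
          (weight_pos _ _).le
        rw [hB]
        gcongr
        exact Finset.single_le_sum (f := fun j => 1 / 2 * max 0 (-Real.log (x.1 j).det))
          (fun j _ => by positivity) (Finset.mem_univ j)
    _ = Real.exp B := by rw [← Finset.sum_mul, sum_weight, one_mul]

theorem objective_le (p : Penalty d) (hn : 0 < n) (data : Fin n → Fin d → ℝ) {x : Param d k}
    (hx : x ∈ manifold d k) :
    objective p data x ≤ logConst d + ∑ j, covBound p n (x.1 j) + 1 / n * p.phi x.2 := by
  have hn' : (0 : ℝ) < n := by exact_mod_cast hn
  have h : ∀ i, component p data i x ≤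
      logConst d + ∑ j, covBound p n (x.1 j) + 1 / n * p.phi x.2 := fun i => by
    have h1 := log_sum_mixTerm_le (augment (data i)) hx
    simp only [covBound, Finset.sum_add_distrib, ← Finset.mul_sum] at h1 ⊢
    rw [component, mul_add]
    simp only [mixTerm] at h1
    linarith
  calc objective p data x ≤ 1 / n * ∑ i : Fin n,
        (logConst d + ∑ j, covBound p n (x.1 j) + 1 / n * p.phi x.2) := by
        unfold objective
        gcongr
        exact h _
    _ = _ := by
        rw [Finset.sum_const, Finset.card_univ, Fintype.card_fin, nsmul_eq_mul, ← mul_assoc,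
          one_div_mul_cancel hn'.ne', one_mul]

/-- The bound separates over eigenvalues: `max 0` is subadditive, and `Ψ ≥ c₀` gives `tr (Ψ S⁻¹) ≥
c₀ tr S⁻¹`. -/
theorem covBound_le (p : Penalty d) (n : ℕ) (hβ : 0 < p.beta) {c₀ : ℝ}
    (hΨ : (p.Psi - c₀ • 1).PosSemidef) {S U : Matrix (Idx d) (Idx d) ℝ} {l : Idx d → ℝ}
    (hS : S.PosDef) (hl : ∀ i, 0 < l i) (hU : U * Uᵀ = 1) (hU' : Uᵀ * U = 1)
    (h : S = U * diagonal l * Uᵀ) :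
    covBound p n S ≤
      ∑ a, eigenBound (p.rho / (2 * n)) (p.beta * c₀ / (2 * n)) (Real.log (l a)) := by
  have h1 : Real.log S.det = ∑ a, Real.log (l a) := by
    rw [det_spectral hU h, Real.log_prod fun a _ => (hl a).ne']
  have h2 : S⁻¹.trace = ∑ a, Real.exp (-Real.log (l a)) := by
    rw [trace_spectral hU' (inv_spectral hl hU hU' h)]
    refine Finset.sum_congr rfl fun a _ => ?_
    rw [Real.exp_neg, Real.exp_log (hl a)]
  have h3 : c₀ * S⁻¹.trace ≤ (p.Psi * S⁻¹).trace := by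
    have := trace_mul_nonneg hΨ hS.inv.posSemidef
    rw [sub_mul, trace_sub, smul_mul_assoc, one_mul, trace_smul, smul_eq_mul] at this
    linarith
  have h4 : max 0 (-Real.log S.det) ≤ ∑ a, max 0 (-Real.log (l a)) := by
    refine max_le (Finset.sum_nonneg fun a _ => le_max_left _ _) ?_
    rw [h1, ← Finset.sum_neg_distrib]
    exact Finset.sum_le_sum fun a _ => le_max_right _ _
  simp only [eigenBound, Finset.sum_sub_distrib, ← Finset.mul_sum, ← h1, ← h2]
  rw [covBound, Penalty.psi]
  have h5 : p.beta / (2 * n) * (c₀ * S⁻¹.trace) ≤ p.beta / (2 * n) * (p.Psi * S⁻¹).trace := by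
    gcongr
  have e1 : p.beta * c₀ / (2 * n) * S⁻¹.trace = p.beta / (2 * n) * (c₀ * S⁻¹.trace) := by ring
  have e2 : (1 / n : ℝ) * (-(p.rho / 2) * Real.log S.det - p.beta / 2 * (p.Psi * S⁻¹).trace) =
      -(p.rho / (2 * n) * Real.log S.det) - p.beta / (2 * n) * (p.Psi * S⁻¹).trace := by ring
  rw [e1, e2]
  linarith

theorem exists_box_of_le_objective (p : Penalty d) (hn : 0 < n) (data : Fin n → Fin d → ℝ)
    (hβ : 0 < p.beta) (hζ : 0 < p.zeta) (hρ : 0 < p.rho) (hΨ : p.Psi.PosDef) (f₀ : ℝ) :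
    ∃ (c M : ℝ) (a : Fin k → ℝ) (b : ℝ), 0 < c ∧
      ∀ x ∈ manifold d k, f₀ ≤ objective p data x → x ∈ box c M a b := by
  have hn' : (0 : ℝ) < n := by exact_mod_cast hn
  obtain ⟨c₀, hc₀, hΨc⟩ := exists_pos_posSemidef_sub hΨ
  set r := p.rho / (2 * n) with hr
  set s := p.beta * c₀ / (2 * n) with hs
  have hr0 : 0 < r := by positivity
  have hs0 : 0 < s := by positivity
  set m := (1 / 2 + r) ^ 2 / (2 * s) with hm
  have hm0 : 0 ≤ m := by positivity
  -- Every summand has an upper bound (`m` or `0`), so a total of at least `f₀` limits the deficit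
  -- of each; `R` is that limit.
  set R := max 0 (Fintype.card (Fin (k + 1) × Idx d) * m + logConst d - f₀) with hR
  obtain ⟨V, hV⟩ := exists_abs_le_of_le_eigenBound hr0 hs0 (le_max_left 0 _ : 0 ≤ R)
  set z := p.zeta / n with hz
  have hz0 : 0 < z := by positivity
  refine ⟨Real.exp (-V), Fintype.card (Idx d) * Real.exp V, fun _ => -(R / z), k * (R / z),
    Real.exp_pos _, fun x hx hf => ?_⟩
  choose U l hl hU hU' hS using fun j => posDef_spectral (hx j)
  set F : Fin (k + 1) × Idx d → ℝ := fun q => eigenBound r s (Real.log (l q.1 q.2)) with hF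
  have hw : ∀ j ∈ Finset.univ, 0 ≤ -Real.log (weight x.2 j) := fun j _ =>
    neg_nonneg.2 (Real.log_nonpos (weight_pos _ _).le (weight_le_one _ _))
  have hsum : f₀ ≤ logConst d + ∑ q, F q - z * ∑ j, -Real.log (weight x.2 j) := by
    refine hf.trans ((objective_le p hn data hx).trans ?_)
    have h1 : ∑ j, covBound p n (x.1 j) ≤ ∑ q, F q := by
      rw [Fintype.sum_prod_type]
      exact Finset.sum_le_sum fun j _ =>
        covBound_le p n hβ hΨc (hx j) (hl j) (hU j) (hU' j) (hS j)
    have h2 : 1 / n * p.phi x.2 = -(z * ∑ j, -Real.log (weight x.2 j)) := by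
      rw [Finset.sum_neg_distrib, Penalty.phi, hz]
      ring
    linarith
  have hw0 : 0 ≤ ∑ j, -Real.log (weight x.2 j) := Finset.sum_nonneg hw
  have hFm : ∀ q ∈ Finset.univ, 0 ≤ m - F q := fun q _ => sub_nonneg.2 (eigenBound_le hr0 hs0 _)
  have hFs : ∑ q, (m - F q) = Fintype.card (Fin (k + 1) × Idx d) * m - ∑ q, F q := by
    rw [Finset.sum_sub_distrib, Finset.sum_const, Finset.card_univ, nsmul_eq_mul]
  have hRle := le_max_right 0 (Fintype.card (Fin (k + 1) × Idx d) * m + logConst d - f₀)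
  rw [← hR] at hRle
  have hlog : ∀ j a, |Real.log (l j a)| ≤ V := fun j a => by
    refine hV _ ?_
    have h1 := Finset.single_le_sum hFm (Finset.mem_univ (j, a))
    rw [hFs] at h1
    have h2 : F (j, a) = eigenBound r s (Real.log (l j a)) := rfl
    have h3 := mul_nonneg hz0.le hw0
    linarith
  have hwR : ∀ j, -Real.log (weight x.2 j) ≤ R / z := fun j => by
    have h1 := Finset.single_le_sum hw (Finset.mem_univ j)
    refine h1.trans ?_
    rw [le_div_iff₀ hz0]
    have h2 := Finset.sum_nonneg hFm
    linarith
  refine ⟨fun j => posSemidef_spectral_sub (hU j) (hS j) fun a => ?_, fun j => ?_, fun i => ?_, ?_⟩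
  · rw [← Real.le_log_iff_exp_le (hl j a)]
    exact (abs_le.1 (hlog j a)).1
  · rw [trace_spectral (hU' j) (hS j), ← nsmul_eq_mul]
    refine Finset.sum_le_card_nsmul _ _ _ fun a _ => ?_
    rw [← Real.log_le_iff_le_exp (hl j a)]
    exact (abs_le.1 (hlog j a)).2
  · have h1 := (Real.log_le_iff_le_exp (weight_pos _ _)).2 (weight_castSucc_le x.2 i)
    have h2 := hwR i.castSucc
    linarith
  · have h1 : ∀ i ∈ Finset.univ, x.2 i ≤ R / z := fun i _ => by
      have h1 := (Real.log_le_iff_le_exp (weight_pos _ _)).2 (weight_last_le x.2 i)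
      have h2 := hwR (Fin.last k)
      linarith
    simpa using Finset.sum_le_card_nsmul _ _ _ h1

open scoped Matrix.Norms.Elementwise in
theorem exists_isMaxOn_objective (p : Penalty d) (hn : 0 < n) (data : Fin n → Fin d → ℝ)
    (hβ : 0 < p.beta) (hζ : 0 < p.zeta) (hρ : 0 < p.rho) (hΨ : p.Psi.PosDef)
    {x₀ : Param d k} (hx₀ : x₀ ∈ manifold d k) :
    ∃ xs ∈ manifold d k, ∀ x ∈ manifold d k, objective p data x ≤ objective p data xs := by
  obtain ⟨c, M, a, b, hc, h⟩ := exists_box_of_le_objective (k := k) p hn data hβ hζ hρ hΨ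
    (objective p data x₀)
  have hcont : ContinuousOn (objective p data : Param d k → ℝ) (box c M a b) :=
    (contDiffOn_objective p data).continuousOn.mono
      ((box_subset_manifold hc).trans manifold_subset_detPos)
  obtain ⟨xs, hxs, hmax⟩ := (isCompact_box hc).exists_isMaxOn ⟨x₀, h x₀ hx₀ le_rfl⟩ hcont
  refine ⟨xs, box_subset_manifold hc hxs, fun x hx => ?_⟩
  rcases le_total (objective p data x₀) (objective p data x) with h1 | h1
  · exact hmax (h x hx h1)
  · exact h1.trans (hmax (h x₀ hx₀ le_rfl))

end Coercivity

/-! ### Expectations of functions of the sampled indices. -/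

section Sampling

variable {n : ℕ} {Ω : Type u} [MeasurableSpace Ω] {P : Measure Ω} [IsProbabilityMeasure P]
  {i : ℕ → Ω → Fin n}

/-- A function of the first `t` sampled indices, as a function of a finite tuple. -/
def ofHistory (hn : 0 < n) {t : ℕ} (v : Finset.range t → Fin n) (r : ℕ) : Fin n :=
  if h : r ∈ Finset.range t then v ⟨r, h⟩ else ⟨0, hn⟩

theorem ofHistory_of_lt (hn : 0 < n) {t r : ℕ} (v : ℕ → Fin n) (hr : r < t) :
    ofHistory hn (fun q : Finset.range t => v q) r = v r := by
  rw [ofHistory, dif_pos (Finset.mem_range.2 hr)]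

/-- Such a function factors through a finite discrete space, so no measurability of gradients or
iterates has to be shown. -/
theorem integrable_of_history (hn : 0 < n) (hi : IsUniformSampling P i) (t : ℕ)
    {Φ : (ℕ → Fin n) → ℝ} (hΦ : ∀ v w, (∀ r < t, v r = w r) → Φ v = Φ w) :
    Integrable (fun s => Φ fun r => i r s) P := by
  have hX : Measurable fun s (r : Finset.range t) => i r s :=
    measurable_pi_iff.2 fun r => hi.measurable r
  have : IsProbabilityMeasure (P.map fun s (r : Finset.range t) => i r s) :=
    Measure.isProbabilityMeasure_map hX.aemeasurable
  have h : Integrable (fun v : Finset.range t → Fin n => Φ (ofHistory hn v))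
      (P.map fun s (r : Finset.range t) => i r s) := Integrable.of_finite
  refine (h.comp_measurable hX).congr (Filter.Eventually.of_forall fun s => ?_)
  exact hΦ _ _ fun r hr => ofHistory_of_lt hn (fun q => i q s) hr

/-- Conditioning on the history: split over the value `a` of `i_t`, whose indicator is independent
of the history and has mean `1/n`. -/
theorem integral_history_index (hn : 0 < n) (hi : IsUniformSampling P i) (t : ℕ)
    {Φ : (ℕ → Fin n) → Fin n → ℝ} (hΦ : ∀ v w a, (∀ r < t, v r = w r) → Φ v a = Φ w a) :
    ∫ s, Φ (fun r => i r s) (i t s) ∂P = ∫ s, 1 / n * ∑ a, Φ (fun r => i r s) a ∂P := by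
  have hXY : IndepFun (fun s (r : Finset.range t) => i r s) (i t) P := by
    have h := hi.indep.indepFun_finset (Finset.range t) {t} (by simp) hi.measurable
    exact h.comp (φ := id) (ψ := fun v : ({t} : Finset ℕ) → Fin n => v ⟨t, by simp⟩)
      measurable_id (measurable_pi_apply _)
  have hint : ∀ a, Integrable (fun s => Φ (fun r => i r s) a) P := fun a =>
    integrable_of_history hn hi t fun v w h => hΦ v w a h
  have hmeas : ∀ a, MeasurableSet (i t ⁻¹' {a}) := fun a =>
    hi.measurable t (measurableSet_singleton a)
  have hprod : ∀ a, ∫ s, Φ (fun r => i r s) a * ({a} : Set (Fin n)).indicator 1 (i t s) ∂P =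
      1 / n * ∫ s, Φ (fun r => i r s) a ∂P := fun a => by
    have e : ∀ s, Φ (fun r => i r s) a =
        Φ (ofHistory hn fun r : Finset.range t => i r s) a := fun s =>
      (hΦ _ _ a fun r hr => ofHistory_of_lt hn (fun q => i q s) hr).symm
    have h := hXY.comp (φ := fun v => Φ (ofHistory hn v) a)
      (ψ := ({a} : Set (Fin n)).indicator (1 : Fin n → ℝ)) (measurable_of_countable _)
      (measurable_of_countable _)
    have h2 : ∫ s, ({a} : Set (Fin n)).indicator (1 : Fin n → ℝ) (i t s) ∂P = 1 / n := by
      have h3 : (fun s => ({a} : Set (Fin n)).indicator (1 : Fin n → ℝ) (i t s)) =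
          (i t ⁻¹' {a}).indicator 1 := rfl
      rw [h3, integral_indicator_one (hmeas a), Measure.real, hi.uniform t a]
      simp
    have h4 := h.integral_fun_mul_eq_mul_integral
      (((hint a).congr (Filter.Eventually.of_forall e)).aestronglyMeasurable)
      ((measurable_of_countable _).comp (hi.measurable t)).aestronglyMeasurable
    simp only [Function.comp_def] at h4
    simp_rw [e]
    rw [h4, h2, mul_comm]
  have hsplit : ∀ s, Φ (fun r => i r s) (i t s) =
      ∑ a, Φ (fun r => i r s) a * ({a} : Set (Fin n)).indicator 1 (i t s) := fun s => by
    rw [Finset.sum_eq_single (i t s)]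
    · simp
    · intro a _ ha
      simp [Ne.symm ha]
    · simp
  simp_rw [hsplit]
  rw [integral_finsetSum _ fun a _ => ?_, integral_const_mul, integral_finsetSum _ fun a _ => hint a,
    Finset.mul_sum]
  · exact Finset.sum_congr rfl fun a _ => hprod a
  · have h : (fun s => Φ (fun r => i r s) a * ({a} : Set (Fin n)).indicator 1 (i t s)) =
        (i t ⁻¹' {a}).indicator fun s => Φ (fun r => i r s) a := by
      funext s
      by_cases hs : i t s = a <;> simp [Set.indicator, hs]
    rw [h]
    exact (hint a).indicator (hmeas a)

end Sampling

/-! ### Expected ascent per step and telescoping. -/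

section Descent

variable {d k n : ℕ} {p : Penalty d} {data : Fin n → Fin d → ℝ} {η : ℝ} {x₀ : Param d k}
  {C : Set (Param d k)}

theorem sgd_congr {v w : ℕ → Fin n} {t : ℕ} (h : ∀ r < t, v r = w r) :
    sgd p data η x₀ v t = sgd p data η x₀ w t := by
  induction t with
  | zero => rfl
  | succ t ih => rw [sgd, sgd, ih fun r hr => h r (hr.trans t.lt_succ_self), h t t.lt_succ_self]

theorem sgd_mem (hP : p.Psi.IsSymm) (hCm : C ⊆ manifold d k) (hx₀ : x₀ ∈ C)
    (hstep : ∀ i, ∀ x ∈ C, retr x (η • componentGrad p data i x) ∈ C) (v : ℕ → Fin n) (t : ℕ) :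
    sgd p data η x₀ v t ∈ C := by
  induction t with
  | zero => exact hx₀
  | succ t ih =>
    rw [sgd, riemGrad_eq (hCm ih) (isRiemGrad_component p hP data _ (hCm ih))]
    exact hstep _ _ ih

theorem objective_step (hP : p.Psi.IsSymm) (hCm : C ⊆ manifold d k) {L G : ℝ} (hL : 0 ≤ L)
    (hLip : LipschitzGrowthOn (fun x => -objective p data x) C L)
    (hG : GradBoundedOn (component p data) C G) {i : Fin n} {x : Param d k} (hx : x ∈ C)
    (hstep : retr x (η • componentGrad p data i x) ∈ C) :
    η * metric x (riemGrad (objective p data) x) (componentGrad p data i x) ≤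
      objective p data (retr x (η • componentGrad p data i x)) - objective p data x +
        L / 2 * (η ^ 2 * G ^ 2) := by
  have hxm := hCm hx
  have hc := isRiemGrad_component p hP data i hxm
  have ho := isRiemGrad_objective p hP data hxm
  have h := hLip x hx _ (tangent_smul η hc.1) hstep
  have hg := hG x hx i
  rw [riemGrad_eq hxm hc] at hg
  rw [riemGrad_eq hxm ho.neg, riemNorm_sq hxm (tangent_smul η hc.1), metric_smul_left,
    metric_smul_right, metric_smul_right, ← riemNorm_sq hxm hc.1, ← neg_one_smul ℝ,
    metric_smul_left] at h
  rw [riemGrad_eq hxm ho]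
  have h2 : riemNorm x (componentGrad p data i x) ^ 2 ≤ G ^ 2 :=
    pow_le_pow_left₀ (Real.sqrt_nonneg _) hg 2
  have h3 : L / 2 * (η ^ 2 * riemNorm x (componentGrad p data i x) ^ 2) ≤
      L / 2 * (η ^ 2 * G ^ 2) := by gcongr
  linarith

theorem expSqGrad_nonneg {Ω : Type u} [MeasurableSpace Ω] {P : Measure Ω}
    {i : ℕ → Ω → Fin n} (t : ℕ) : 0 ≤ expSqGrad p data η x₀ P i t :=
  integral_nonneg fun _ => sq_nonneg _

variable {Ω : Type u} [MeasurableSpace Ω] {P : Measure Ω} [IsProbabilityMeasure P]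
  {i : ℕ → Ω → Fin n}

theorem integrable_sqGrad (hn : 0 < n) (hi : IsUniformSampling P i) (t : ℕ) :
    Integrable (fun s => sqGrad p data η x₀ (fun r => i r s) t) P :=
  integrable_of_history (Φ := fun v => sqGrad p data η x₀ v t) hn hi t
    fun v w h => by simp only [sqGrad, sgd_congr h]

theorem integrable_objective_sgd (hn : 0 < n) (hi : IsUniformSampling P i) (t : ℕ) :
    Integrable (fun s => objective p data (sgd p data η x₀ (fun r => i r s) t)) P :=
  integrable_of_history (Φ := fun v => objective p data (sgd p data η x₀ v t)) hn hi t
    fun v w h => by rw [sgd_congr h]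

theorem expSqGrad_step (hn : 0 < n) (hP : p.Psi.IsSymm) (hCm : C ⊆ manifold d k) (hx₀ : x₀ ∈ C)
    (hstep : ∀ i, ∀ x ∈ C, retr x (η • componentGrad p data i x) ∈ C)
    {L G : ℝ} (hL : 0 ≤ L) (hLip : LipschitzGrowthOn (fun x => -objective p data x) C L)
    (hG : GradBoundedOn (component p data) C G) (hi : IsUniformSampling P i) (t : ℕ) :
    η * expSqGrad p data η x₀ P i t ≤
      (∫ s, objective p data (sgd p data η x₀ (fun r => i r s) (t + 1)) ∂P) -
        (∫ s, objective p data (sgd p data η x₀ (fun r => i r s) t) ∂P) +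
          L / 2 * (η ^ 2 * G ^ 2) := by
  set Φ : (ℕ → Fin n) → Fin n → ℝ := fun v a => metric (sgd p data η x₀ v t)
    (riemGrad (objective p data) (sgd p data η x₀ v t))
    (componentGrad p data a (sgd p data η x₀ v t)) with hΦ
  have hΦc : ∀ v w a, (∀ r < t, v r = w r) → Φ v a = Φ w a := fun v w a h => by
    simp only [hΦ, sgd_congr h]
  have hmem := sgd_mem (data := data) hP hCm hx₀ hstep
  -- The stochastic gradient is unbiased: averaging `⟨∇f, ∇f_a⟩` over `a` gives `‖∇f‖²`.
  have e1 : expSqGrad p data η x₀ P i t = ∫ s, Φ (fun r => i r s) (i t s) ∂P := by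
    rw [integral_history_index hn hi t hΦc]
    refine integral_congr_ae (Filter.Eventually.of_forall fun s => ?_)
    have hx := hCm (hmem (fun r => i r s) t)
    have ho := isRiemGrad_objective p hP data hx
    simp only [hΦ, sqGrad]
    rw [riemGrad_eq hx ho, riemNorm_sq hx ho.1, ← metric_sum_right, ← metric_smul_right]
  have hint1 := integrable_objective_sgd (p := p) (data := data) (η := η) (x₀ := x₀) hn hi t
  have hint2 := integrable_objective_sgd (p := p) (data := data) (η := η) (x₀ := x₀) hn hi (t + 1)
  have hint3 : Integrable (fun s => Φ (fun r => i r s) (i t s)) P :=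
    integrable_of_history (Φ := fun v => Φ v (v t)) hn hi (t + 1) fun v w h => by
      rw [h t t.lt_succ_self]
      exact hΦc _ _ _ fun r hr => h r (hr.trans t.lt_succ_self)
  rw [e1, ← integral_const_mul, ← integral_sub hint2 hint1]
  calc _ ≤ ∫ s, ((objective p data (sgd p data η x₀ (fun r => i r s) (t + 1)) -
          objective p data (sgd p data η x₀ (fun r => i r s) t)) +
            L / 2 * (η ^ 2 * G ^ 2)) ∂P := by
        refine integral_mono (hint3.const_mul η)
          ((hint2.sub hint1).add (integrable_const _)) fun s => ?_
        have hx := hmem (fun r => i r s) t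
        have h := objective_step hP hCm hL hLip hG hx (hstep (i t s) _ hx)
        have e2 : sgd p data η x₀ (fun r => i r s) (t + 1) =
            retr (sgd p data η x₀ (fun r => i r s) t) (η •
              componentGrad p data (i t s) (sgd p data η x₀ (fun r => i r s) t)) := by
          rw [sgd, riemGrad_eq (hCm hx) (isRiemGrad_component p hP data _ (hCm hx))]
        beta_reduce
        rw [e2]
        exact h
    _ = _ := by
        refine (integral_add (hint2.sub hint1) (integrable_const _)).trans ?_
        simp [Pi.sub_apply]

/-- The horizon `T` is independent of `η` here, so the sum may also run over more steps than the
step size was tuned for. -/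
theorem sum_expSqGrad_le (hn : 0 < n) (hP : p.Psi.IsSymm) (hCm : C ⊆ manifold d k) (hx₀ : x₀ ∈ C)
    (hstep : ∀ i, ∀ x ∈ C, retr x (η • componentGrad p data i x) ∈ C)
    {L G : ℝ} (hL : 0 ≤ L) (hLip : LipschitzGrowthOn (fun x => -objective p data x) C L)
    (hG : GradBoundedOn (component p data) C G) (hi : IsUniformSampling P i) {fs : ℝ}
    (hfs : ∀ x ∈ C, objective p data x ≤ fs) (T : ℕ) :
    η * ∑ t ∈ Finset.range T, expSqGrad p data η x₀ P i t ≤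
      fs - objective p data x₀ + T * (L / 2 * (η ^ 2 * G ^ 2)) := by
  set F : ℕ → ℝ := fun t => ∫ s, objective p data (sgd p data η x₀ (fun r => i r s) t) ∂P with hF
  have hF0 : F 0 = objective p data x₀ := by simp [hF, sgd]
  have hFT : F T ≤ fs := by
    calc F T ≤ ∫ _, fs ∂P := integral_mono (integrable_objective_sgd hn hi T)
          (integrable_const _) fun s => hfs _ (sgd_mem hP hCm hx₀ hstep _ T)
      _ = fs := by simp
  calc η * ∑ t ∈ Finset.range T, expSqGrad p data η x₀ P i t
      ≤ ∑ t ∈ Finset.range T, (F (t + 1) - F t + L / 2 * (η ^ 2 * G ^ 2)) := by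
        rw [Finset.mul_sum]
        exact Finset.sum_le_sum fun t _ => expSqGrad_step hn hP hCm hx₀ hstep hL hLip hG hi t
    _ = F T - F 0 + T * (L / 2 * (η ^ 2 * G ^ 2)) := by
        rw [Finset.sum_add_distrib, Finset.sum_range_sub, Finset.sum_const, Finset.card_range,
          nsmul_eq_mul]
    _ ≤ _ := by linarith

theorem iInf_le_of_sum_le {T : ℕ} (hT : 1 ≤ T) {I : Finset ℕ} (hI : I.card = T) {E : ℕ → ℝ}
    (hE : ∀ t, 0 ≤ E t) {c Δ B : ℝ} (hc : 0 < c)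
    (h : c / √(T : ℝ) * ∑ t ∈ I, E t ≤ Δ + T * (B / 2 * (c / √(T : ℝ)) ^ 2)) :
    (⨅ t : I, E t) ≤ 1 / √(T : ℝ) * (Δ / c + B * c / 2) := by
  have hT' : (0 : ℝ) < T := by exact_mod_cast hT
  have hs : 0 < √(T : ℝ) := Real.sqrt_pos.2 hT'
  have h1 : T * (⨅ t : I, E t) ≤ ∑ t ∈ I, E t := by
    rw [← hI, ← nsmul_eq_mul]
    refine Finset.card_nsmul_le_sum _ _ _ fun t ht => ?_
    exact ciInf_le (f := fun t : I => E t) ⟨0, by rintro _ ⟨t, rfl⟩; exact hE t⟩ ⟨t, ht⟩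
  have h2 := (mul_le_mul_of_nonneg_left h1 (by positivity : 0 ≤ c / √(T : ℝ))).trans h
  set m := ⨅ t : I, E t
  set q := √(T : ℝ) with hq
  have hqT : (T : ℝ) = q ^ 2 := (Real.sq_sqrt hT'.le).symm
  rw [hqT] at h2
  have e1 : c / q * (q ^ 2 * m) = c * q * m := by field_simp
  have e2 : q ^ 2 * (B / 2 * (c / q) ^ 2) = B / 2 * c ^ 2 := by field_simp
  rw [e1, e2] at h2
  have e3 : 1 / q * (Δ / c + B * c / 2) = (Δ + B / 2 * c ^ 2) / (c * q) := by field_simp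
  rw [e3, le_div_iff₀ (by positivity)]
  linarith

end Descent

/-! ### Asymptotics and the main theorem. -/

theorem eventually_admissible (c r : ℝ) :
    ∀ᶠ T : ℕ in Filter.atTop, 1 ≤ T ∧ c / √(T : ℝ) * r ≤ 2 := by
  have h1 : Filter.Tendsto (fun T : ℕ => √(T : ℝ)) Filter.atTop Filter.atTop :=
    Real.tendsto_sqrt_atTop.comp tendsto_natCast_atTop_atTop
  have h2 := (h1.const_div_atTop c).mul_const r
  rw [zero_mul] at h2
  exact (Filter.eventually_ge_atTop 1).and
    ((h2.eventually_lt_const (by norm_num : (0 : ℝ) < 2)).mono fun _ h => h.le)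

theorem isBigO_iInf {E : ℕ → ℕ → ℝ} (hE : ∀ T t, 0 ≤ E T t) (I : ℕ → Finset ℕ) {K c r : ℝ}
    (h : ∀ T : ℕ, 1 ≤ T → c / √(T : ℝ) * r ≤ 2 → (⨅ t : I T, E T t) ≤ 1 / √(T : ℝ) * K) :
    (fun T : ℕ => ⨅ t : I T, E T t) =O[Filter.atTop] (fun T : ℕ => 1 / √(T : ℝ)) := by
  refine Asymptotics.IsBigO.of_bound K ?_
  filter_upwards [eventually_admissible c r] with T hT
  rw [Real.norm_of_nonneg (Real.iInf_nonneg fun t : I T => hE T t), Real.norm_of_nonneg (by positivity),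
    mul_comm]
  exact h T hT.1 hT.2

end PenalizedGMM

theorem mainTheorem6 {d k n : ℕ} (hn : 0 < n) (data : Fin n → Fin d → ℝ)
    (p : PenalizedGMM.Penalty d)
    (hα : 0 < p.alpha) (hβ : 0 < p.beta) (hκ : 0 < p.kappa) (hζ : 0 < p.zeta)
    (hρ : 0 < p.rho) (hLam : p.Lam.PosDef)
    (x₀ : PenalizedGMM.Param d k) (hx₀ : x₀ ∈ PenalizedGMM.manifold d k)
    (c : ℝ) (hc : 0 < c) :
    -- the penalized objective attains its maximum `f* = f(x*)` on the manifold
    ∃ xs ∈ PenalizedGMM.manifold d k,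
      (∀ x ∈ PenalizedGMM.manifold d k,
        PenalizedGMM.objective p data x ≤ PenalizedGMM.objective p data xs) ∧
    -- a compact set, independent of `T`, contains all the iterates for all admissible `T`
    ∃ C : Set (PenalizedGMM.Param d k), IsCompact C ∧ C ⊆ PenalizedGMM.manifold d k ∧
      (∀ T : ℕ, 1 ≤ T → c / √(T : ℝ) * (1 + p.rho / n) ≤ 2 → ∀ (i : ℕ → Fin n) (t : ℕ),
        PenalizedGMM.sgd p data (c / √(T : ℝ)) x₀ i t ∈ C) ∧
      -- the bound on the `T` iterates `x_0, …, x_{T-1}`, for all valid constants `L`, `G` on `C`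
      (∀ L G : ℝ, 0 ≤ L →
        PenalizedGMM.LipschitzGrowthOn (fun x => -PenalizedGMM.objective p data x) C L →
        PenalizedGMM.GradBoundedOn (PenalizedGMM.component p data) C G →
        ∀ (Ω : Type u) [MeasurableSpace Ω] (P : Measure Ω) [IsProbabilityMeasure P]
          (i : ℕ → Ω → Fin n), PenalizedGMM.IsUniformSampling P i →
        ∀ T : ℕ, 1 ≤ T → c / √(T : ℝ) * (1 + p.rho / n) ≤ 2 →
          (⨅ t : Finset.range T, PenalizedGMM.expSqGrad p data (c / √(T : ℝ)) x₀ P i t) ≤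
            1 / √(T : ℝ) * ((PenalizedGMM.objective p data xs - PenalizedGMM.objective p data x₀) / c
              + L * c / 2 * G ^ 2)) ∧
      -- valid constants exist, and with them the bound on the iterates `x_1, …, x_T`
      (∃ L G : ℝ, 0 ≤ L ∧
        PenalizedGMM.LipschitzGrowthOn (fun x => -PenalizedGMM.objective p data x) C L ∧
        PenalizedGMM.GradBoundedOn (PenalizedGMM.component p data) C G ∧
        ∀ (Ω : Type u) [MeasurableSpace Ω] (P : Measure Ω) [IsProbabilityMeasure P]
          (i : ℕ → Ω → Fin n), PenalizedGMM.IsUniformSampling P i →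
          (∀ T : ℕ, 1 ≤ T → c / √(T : ℝ) * (1 + p.rho / n) ≤ 2 →
            (∀ t, Integrable
              (fun s => PenalizedGMM.sqGrad p data (c / √(T : ℝ)) x₀ (fun r => i r s) t) P) ∧
            (⨅ t : Finset.Icc 1 T, PenalizedGMM.expSqGrad p data (c / √(T : ℝ)) x₀ P i t) ≤
              1 / √(T : ℝ) *
                ((PenalizedGMM.objective p data xs - PenalizedGMM.objective p data x₀) / c
                  + L * c / 2 * G ^ 2)) ∧
          (fun T : ℕ => ⨅ t : Finset.range T,
              PenalizedGMM.expSqGrad p data (c / √(T : ℝ)) x₀ P i t)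
            =O[Filter.atTop] (fun T : ℕ => 1 / √(T : ℝ)) ∧
          (fun T : ℕ => ⨅ t : Finset.Icc 1 T,
              PenalizedGMM.expSqGrad p data (c / √(T : ℝ)) x₀ P i t)
            =O[Filter.atTop] (fun T : ℕ => 1 / √(T : ℝ))) := by
  have hΨ := PenalizedGMM.posDef_Psi p hα hβ hκ hLam
  have hP : p.Psi.IsSymm := hΨ.1
  obtain ⟨xs, hxs, hmax⟩ := PenalizedGMM.exists_isMaxOn_objective p hn data hβ hζ hρ hΨ hx₀
  obtain ⟨c₁, M, a, b, hc₁, hx₀C, hstep⟩ :=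
    PenalizedGMM.exists_invariant_box p data hn hβ hζ hρ hΨ hx₀
  have hC := PenalizedGMM.isCompact_box (d := d) (M := M) (a := a) (b := b) hc₁
  have hCm := PenalizedGMM.box_subset_manifold (d := d) (M := M) (a := a) (b := b) hc₁
  obtain ⟨L', hL', hLip⟩ := PenalizedGMM.exists_lipschitzGrowthOn p hP data hC
    PenalizedGMM.convex_box hCm
  obtain ⟨G', hG'⟩ := PenalizedGMM.exists_gradBoundedOn p hP data hC hCm
  have hfs := fun x hx => hmax x (hCm hx)
  have hη : ∀ T : ℕ, 0 ≤ c / √(T : ℝ) := fun T => by positivity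
  -- Enlarging `L` preserves validity; the doubled constant is the one published for part (b).
  have hLip2 : PenalizedGMM.LipschitzGrowthOn (fun x => -PenalizedGMM.objective p data x)
      (PenalizedGMM.box c₁ M a b) (2 * L') := fun x hx ξ hξ hξC => by
    have h := hLip x hx ξ hξ hξC
    have h2 := mul_nonneg hL' (sq_nonneg (PenalizedGMM.riemNorm x ξ))
    linarith
  have hbound : ∀ L G : ℝ, 0 ≤ L →
      PenalizedGMM.LipschitzGrowthOn (fun x => -PenalizedGMM.objective p data x)
        (PenalizedGMM.box c₁ M a b) L →
      PenalizedGMM.GradBoundedOn (PenalizedGMM.component p data) (PenalizedGMM.box c₁ M a b) G →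
      ∀ (Ω : Type u) [MeasurableSpace Ω] (P : Measure Ω) [IsProbabilityMeasure P]
        (i : ℕ → Ω → Fin n), PenalizedGMM.IsUniformSampling P i →
      ∀ T : ℕ, 1 ≤ T → c / √(T : ℝ) * (1 + p.rho / n) ≤ 2 →
        (⨅ t : Finset.range T, PenalizedGMM.expSqGrad p data (c / √(T : ℝ)) x₀ P i t) ≤
          1 / √(T : ℝ) * ((PenalizedGMM.objective p data xs - PenalizedGMM.objective p data x₀) / c
            + L * c / 2 * G ^ 2) := by
    intro L G hL hLipL hG Ω _ P _ i hi T hT hadm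
    have h := PenalizedGMM.sum_expSqGrad_le hn hP hCm hx₀C (hstep _ (hη T) hadm) hL hLipL hG hi
      hfs T
    have h2 := PenalizedGMM.iInf_le_of_sum_le hT (Finset.card_range T)
      (PenalizedGMM.expSqGrad_nonneg (p := p) (data := data) (η := c / √(T : ℝ)) (x₀ := x₀)
        (P := P) (i := i)) hc
      (Δ := PenalizedGMM.objective p data xs - PenalizedGMM.objective p data x₀)
      (B := L * G ^ 2) (h.trans_eq (by ring))
    exact h2.trans_eq (by ring)
  have hbound2 : ∀ (Ω : Type u) [MeasurableSpace Ω] (P : Measure Ω) [IsProbabilityMeasure P]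
        (i : ℕ → Ω → Fin n), PenalizedGMM.IsUniformSampling P i →
      ∀ T : ℕ, 1 ≤ T → c / √(T : ℝ) * (1 + p.rho / n) ≤ 2 →
        (⨅ t : Finset.Icc 1 T, PenalizedGMM.expSqGrad p data (c / √(T : ℝ)) x₀ P i t) ≤
          1 / √(T : ℝ) * ((PenalizedGMM.objective p data xs - PenalizedGMM.objective p data x₀) / c
            + 2 * L' * c / 2 * G' ^ 2) := by
    intro Ω _ P _ i hi T hT hadm
    -- Reaching `x_T` takes the times `0, …, T`, that is `T + 1` error terms; the term at time `0`
    -- is then dropped.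
    have h := PenalizedGMM.sum_expSqGrad_le hn hP hCm hx₀C (hstep _ (hη T) hadm) hL' hLip hG' hi
      hfs (T + 1)
    set E := PenalizedGMM.expSqGrad p data (c / √(T : ℝ)) x₀ P i with hEdef
    have hE : ∀ t, 0 ≤ E t := PenalizedGMM.expSqGrad_nonneg
    have h1 : ∑ t ∈ Finset.Icc 1 T, E t ≤ ∑ t ∈ Finset.range (T + 1), E t := by
      refine Finset.sum_le_sum_of_subset_of_nonneg (fun t ht => ?_) fun t _ _ => hE t
      rw [Finset.mem_Icc] at ht
      exact Finset.mem_range.2 (Nat.lt_succ_of_le ht.2)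
    -- `T + 1 ≤ 2 T` turns the additional step into the factor `2` on `L'`.
    have h2 : ((T + 1 : ℕ) : ℝ) * (L' / 2 * ((c / √(T : ℝ)) ^ 2 * G' ^ 2)) ≤
        (2 * T) * (L' / 2 * ((c / √(T : ℝ)) ^ 2 * G' ^ 2)) := by
      have hT1 : (1 : ℝ) ≤ T := by exact_mod_cast hT
      refine mul_le_mul_of_nonneg_right ?_ (by positivity)
      push_cast
      linarith
    have h3 := mul_le_mul_of_nonneg_left h1 (hη T)
    have h4 := PenalizedGMM.iInf_le_of_sum_le hT (I := Finset.Icc 1 T) (by simp) hE hc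
      (Δ := PenalizedGMM.objective p data xs - PenalizedGMM.objective p data x₀)
      (B := 2 * L' * G' ^ 2) (by linarith)
    exact h4.trans_eq (by ring)
  refine ⟨xs, hxs, hmax, PenalizedGMM.box c₁ M a b, hC, hCm,
    fun T hT hadm i t => PenalizedGMM.sgd_mem hP hCm hx₀C (hstep _ (hη T) hadm) i t, hbound,
    2 * L', G', by positivity, hLip2, hG', fun Ω _ P _ i hi => ⟨fun T hT hadm =>
      ⟨PenalizedGMM.integrable_sqGrad hn hi, hbound2 Ω P i hi T hT hadm⟩, ?_, ?_⟩⟩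
  · exact PenalizedGMM.isBigO_iInf (fun _ => PenalizedGMM.expSqGrad_nonneg) Finset.range
      (hbound _ _ (by positivity) hLip2 hG' Ω P i hi)
  · exact PenalizedGMM.isBigO_iInf (fun _ => PenalizedGMM.expSqGrad_nonneg) (Finset.Icc 1)
      (hbound2 Ω P i hi)
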